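/- All rings are associative and unital, and ring homomorphisms are unital. Let $f\colon B\to A$ be a ring homomorphism (a ring extension), through which $A$ is regarded as a $(B,B)$-bimodule. The extension $B\to A$ is called a *Frobenius extension* (of the first kind) if $A$ is a finitely generated projective right $B$-module and $A\cong \mathrm{Hom}_B(A,B)$ as $(B,A)$-bimodules, where $\mathrm{Hom}_B(A,B)$ is the group of right $B$-linear maps with $(b\varphi a)(x)=b\,\varphi(ax)$. An *$A$-coring* is an $(A,A)$-bimodule $\mathfrak C$ with $(A,A)$-bimodule maps $\Delta\colon\mathfrak C\to\mathfrak C\otimes_A\mathfrak C$ and $\varepsilon\colon\mathfrak C\to A$ such that $(I\otimes_A\Delta)\Delta=(\Delta\otimes_A I)\Delta$ and $(I\otimes_A\varepsilon)\Delta=(\varepsilon\otimes_A I)\Delta=I_{\mathfrak C}$. A *right $\mathfrak C$-comodule* is a right $A$-module $M$ with a right $A$-linear map $\rho\colon M\to M\otimes_A\mathfrak C$ such that $(I\otimes_A\Delta)\rho=(\rho\otimes_A I)\rho$ and $(I\otimes_A\varepsilon)\rho=I_M$; morphisms of comodules are the right $A$-linear maps that commute with the coactions. The coring $\mathfrak C$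 is called a *Frobenius coring* if the forgetful functor $F$ from right $\mathfrak C$-comodules to right $A$-modules is a Frobenius functor, that is, if some functor is both a right adjoint and a left adjoint of $F$. The *Sweedler coring* of $B\to A$ is the $(A,A)$-bimodule $A\otimes_B A$ with coproduct $\Delta(a\otimes_B a')=(a\otimes_B 1)\otimes_A(1\otimes_B a')$ and counit $\varepsilon(a\otimes_B a')=aa'$. **Theorem.** If $B\to A$ is a Frobenius extension, then the Sweedler coring $A\otimes_B A$ is a Frobenius coring. Conversely, if $A$ is faithfully flat as a left $B$-module or as a right $B$-module, and $A\otimes_B A$ is a Frobenius coring, then $B\to A$ is a Frobenius extension. -/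

import Mathlib

open CategoryTheory MulOpposite
open scoped TensorProduct

namespace NC

/-! ### Tensor products over a noncommutative ring

Right modules over `S` are modules over `Sᵐᵒᵖ`: the element `m s` is written `op s • m`. -/

section Tensor

/-- The subgroup of `M ⊗_ℤ N` generated by all `ms ⊗ n - m ⊗ sn`. -/
def balancedRel (S M N : Type*) [Ring S] [AddCommGroup M] [Module Sᵐᵒᵖ M]
    [AddCommGroup N] [Module S N] : AddSubgroup (M ⊗[ℤ] N) :=
  AddSubgroup.closure {z | ∃ (m : M) (s : S) (n : N), z = (op s • m) ⊗ₜ[ℤ] n - m ⊗ₜ[ℤ] (s • n)}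

/-- The tensor product `M ⊗_S N` of a right `S`-module `M` and a left `S`-module `N`,
an abelian group. -/
def BTensor (S M N : Type*) [Ring S] [AddCommGroup M] [Module Sᵐᵒᵖ M]
    [AddCommGroup N] [Module S N] : Type _ :=
  (M ⊗[ℤ] N) ⧸ balancedRel S M N

namespace BTensor

section Basic

variable {S M N P : Type*} [Ring S] [AddCommGroup M] [Module Sᵐᵒᵖ M]
  [AddCommGroup N] [Module S N] [AddCommGroup P]

instance : AddCommGroup (BTensor S M N) :=
  inferInstanceAs (AddCommGroup ((M ⊗[ℤ] N) ⧸ balancedRel S M N))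

variable (S) in
/-- The pure tensor `m ⊗_S n`. -/
def tmul (m : M) (n : N) : BTensor S M N :=
  QuotientAddGroup.mk' (balancedRel S M N) (m ⊗ₜ[ℤ] n)

theorem add_tmul (m m' : M) (n : N) : tmul S (m + m') n = tmul S m n + tmul S m' n := by
  simp only [tmul, TensorProduct.add_tmul, map_add]; rfl

theorem tmul_add (m : M) (n n' : N) : tmul S m (n + n') = tmul S m n + tmul S m n' := by
  simp only [tmul, TensorProduct.tmul_add, map_add]; rfl

theorem smul_tmul (m : M) (s : S) (n : N) : tmul S (op s • m) n = tmul S m (s • n) := by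
  refine (QuotientAddGroup.eq_iff_sub_mem).2 ?_
  exact AddSubgroup.subset_closure ⟨m, s, n, rfl⟩

@[elab_as_elim]
theorem induction_on {p : BTensor S M N → Prop} (x : BTensor S M N)
    (zero : p 0) (tmul : ∀ m n, p (tmul S m n)) (add : ∀ x y, p x → p y → p (x + y)) : p x := by
  obtain ⟨z, rfl⟩ := QuotientAddGroup.mk'_surjective (balancedRel S M N) x
  induction z using TensorProduct.induction_on with
  | zero => exact zero
  | tmul m n => exact tmul m n
  | add a b ha hb => rw [map_add]; exact add _ _ ha hb

/-- The universal property: a biadditive `S`-balanced map induces an additive map on `M ⊗_S N`. -/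
def lift (f : M →+ N →+ P) (hf : ∀ (m : M) (s : S) (n : N), f (op s • m) n = f m (s • n)) :
    BTensor S M N →+ P :=
  QuotientAddGroup.lift (balancedRel S M N)
    (TensorProduct.liftAddHom f (fun r m n => by simp)) (by
      refine (AddSubgroup.closure_le _).2 ?_
      rintro z ⟨m, s, n, rfl⟩
      simp [hf])

@[simp]
theorem lift_tmul (f : M →+ N →+ P)
    (hf : ∀ (m : M) (s : S) (n : N), f (op s • m) n = f m (s • n)) (m : M) (n : N) :
    lift f hf (tmul S m n) = f m n := rfl

/-- Two additive maps out of `M ⊗_S N` that agree on pure tensors are equal. -/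
theorem hom_ext {f g : BTensor S M N →+ P} (h : ∀ m n, f (tmul S m n) = g (tmul S m n)) :
    f = g := by
  ext x
  induction x using induction_on with
  | zero => simp
  | tmul m n => exact h m n
  | add x y hx hy => rw [map_add, map_add, hx, hy]

/-- The pure tensor as a biadditive map. -/
def mkHom (S M N : Type*) [Ring S] [AddCommGroup M] [Module Sᵐᵒᵖ M]
    [AddCommGroup N] [Module S N] : M →+ N →+ BTensor S M N :=
  AddMonoidHom.mk' (fun m => AddMonoidHom.mk' (fun n => tmul S m n) (tmul_add m))
    (fun m m' => by ext n; exact add_tmul m m' n)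

@[simp]
theorem mkHom_apply (m : M) (n : N) : mkHom S M N m n = tmul S m n := rfl

end Basic

section Map

variable {S M N M' N' : Type*} [Ring S] [AddCommGroup M] [Module Sᵐᵒᵖ M]
  [AddCommGroup N] [Module S N] [AddCommGroup M'] [Module Sᵐᵒᵖ M']
  [AddCommGroup N'] [Module S N']

/-- The map `f ⊗_S g`, for `f` right `S`-linear and `g` left `S`-linear. -/
def map (f : M →ₗ[Sᵐᵒᵖ] M') (g : N →ₗ[S] N') : BTensor S M N →+ BTensor S M' N' :=
  lift (((mkHom S M' N').comp f.toAddMonoidHom).compr₂ (.id _) |>.compl₂ g.toAddMonoidHom)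
    (fun m s n => by simp [smul_tmul])

@[simp]
theorem map_tmul (f : M →ₗ[Sᵐᵒᵖ] M') (g : N →ₗ[S] N') (m : M) (n : N) :
    map f g (tmul S m n) = tmul S (f m) (g n) := rfl

end Map

section Actions

variable {S M N : Type*} [Ring S] [AddCommGroup M] [Module Sᵐᵒᵖ M]
  [AddCommGroup N] [Module S N]

/-- If `M` is an `(R,S)`-bimodule then `M ⊗_S N` is a left `R`-module, `r (m ⊗ n) = rm ⊗ n`. -/
instance leftModule {R : Type*} [Ring R] [Module R M] [SMulCommClass R Sᵐᵒᵖ M] :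
    Module R (BTensor S M N) where
  smul r := map (DistribSMul.toLinearMap Sᵐᵒᵖ M r) LinearMap.id
  one_smul x := DFunLike.congr_fun (f := map (DistribSMul.toLinearMap Sᵐᵒᵖ M (1 : R))
    LinearMap.id) (g := .id _) (hom_ext fun m n => by simp) x
  mul_smul r r' x := DFunLike.congr_fun (f := map (DistribSMul.toLinearMap Sᵐᵒᵖ M (r * r'))
    LinearMap.id) (g := (map (DistribSMul.toLinearMap Sᵐᵒᵖ M r) LinearMap.id).comp
      (map (DistribSMul.toLinearMap Sᵐᵒᵖ M r') LinearMap.id))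
    (hom_ext fun m n => by simp [mul_smul]) x
  smul_zero r := map_zero (map (DistribSMul.toLinearMap Sᵐᵒᵖ M r) LinearMap.id)
  smul_add r := map_add (map (DistribSMul.toLinearMap Sᵐᵒᵖ M r) LinearMap.id)
  add_smul r r' x := DFunLike.congr_fun (f := map (DistribSMul.toLinearMap Sᵐᵒᵖ M (r + r'))
    LinearMap.id) (g := map (DistribSMul.toLinearMap Sᵐᵒᵖ M r) LinearMap.id +
      map (DistribSMul.toLinearMap Sᵐᵒᵖ M r') LinearMap.id)
    (hom_ext fun m n => by simp [add_smul, add_tmul]) x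
  zero_smul x := DFunLike.congr_fun (f := map (DistribSMul.toLinearMap Sᵐᵒᵖ M (0 : R))
    LinearMap.id) (g := 0) (hom_ext fun m n => by
      have h : tmul S (0 : M) n = 0 := DFunLike.congr_fun (map_zero (mkHom S M N)) n
      simp [h]) x

/-- If `N` is an `(S,T)`-bimodule then `M ⊗_S N` is a right `T`-module, `(m ⊗ n) t = m ⊗ nt`. -/
instance rightModule {T : Type*} [Ring T] [Module Tᵐᵒᵖ N] [SMulCommClass Tᵐᵒᵖ S N] :
    Module Tᵐᵒᵖ (BTensor S M N) where
  smul t := map LinearMap.id (DistribSMul.toLinearMap S N t)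
  one_smul x := DFunLike.congr_fun (f := map LinearMap.id
    (DistribSMul.toLinearMap S N (1 : Tᵐᵒᵖ))) (g := .id _) (hom_ext fun m n => by simp) x
  mul_smul t t' x := DFunLike.congr_fun (f := map LinearMap.id
    (DistribSMul.toLinearMap S N (t * t'))) (g := (map LinearMap.id
      (DistribSMul.toLinearMap S N t)).comp (map LinearMap.id (DistribSMul.toLinearMap S N t')))
    (hom_ext fun m n => by simp [mul_smul]) x
  smul_zero t := map_zero (map LinearMap.id (DistribSMul.toLinearMap S N t))
  smul_add t := map_add (map LinearMap.id (DistribSMul.toLinearMap S N t))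
  add_smul t t' x := DFunLike.congr_fun (f := map LinearMap.id
    (DistribSMul.toLinearMap S N (t + t'))) (g := map LinearMap.id
      (DistribSMul.toLinearMap S N t) + map LinearMap.id (DistribSMul.toLinearMap S N t'))
    (hom_ext fun m n => by simp [add_smul, tmul_add]) x
  zero_smul x := DFunLike.congr_fun (f := map LinearMap.id
    (DistribSMul.toLinearMap S N (0 : Tᵐᵒᵖ))) (g := 0) (hom_ext fun m n => by
      have h : tmul S m (0 : N) = 0 := map_zero (mkHom S M N m)
      simp [h]) x

@[simp]
theorem left_smul_tmul {R : Type*} [Ring R] [Module R M] [SMulCommClass R Sᵐᵒᵖ M]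
    (r : R) (m : M) (n : N) : r • tmul S m n = tmul S (r • m) n := rfl

@[simp]
theorem right_smul_tmul {T : Type*} [Ring T] [Module Tᵐᵒᵖ N] [SMulCommClass Tᵐᵒᵖ S N]
    (t : Tᵐᵒᵖ) (m : M) (n : N) : t • tmul S m n = tmul S m (t • n) := rfl

instance smulCommClass {R T : Type*} [Ring R] [Ring T] [Module R M] [SMulCommClass R Sᵐᵒᵖ M]
    [Module Tᵐᵒᵖ N] [SMulCommClass Tᵐᵒᵖ S N] :
    SMulCommClass R Tᵐᵒᵖ (BTensor S M N) where
  smul_comm r t x := by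
    induction x using induction_on with
    | zero => simp
    | tmul m n => rfl
    | add x y hx hy => simp only [smul_add, hx, hy]

instance smulCommClass' {R T : Type*} [Ring R] [Ring T] [Module R M] [SMulCommClass R Sᵐᵒᵖ M]
    [Module Tᵐᵒᵖ N] [SMulCommClass Tᵐᵒᵖ S N] :
    SMulCommClass Tᵐᵒᵖ R (BTensor S M N) :=
  SMulCommClass.symm _ _ _

end Actions

section Unitors

/-- The canonical map `S ⊗_S N → N`, `s ⊗ n ↦ sn`. -/
def lid (S N : Type*) [Ring S] [AddCommGroup N] [Module S N] : BTensor S S N →+ N :=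
  lift (AddMonoidHom.smul (R := S) (M := N)) (fun m s n => by simp [mul_smul])

/-- The canonical map `M ⊗_S S → M`, `m ⊗ s ↦ ms`. -/
def rid (S M : Type*) [Ring S] [AddCommGroup M] [Module Sᵐᵒᵖ M] : BTensor S M S →+ M :=
  lift ((AddMonoidHom.smul (R := Sᵐᵒᵖ) (M := M)).comp opAddEquiv.toAddMonoidHom).flip
    (fun m s n => by simp [mul_smul])

@[simp]
theorem lid_tmul {S N : Type*} [Ring S] [AddCommGroup N] [Module S N] (s : S) (n : N) :
    lid S N (tmul S s n) = s • n := rfl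

@[simp]
theorem rid_tmul {S M : Type*} [Ring S] [AddCommGroup M] [Module Sᵐᵒᵖ M] (m : M) (s : S) :
    rid S M (tmul S m s) = op s • m := rfl

end Unitors

section Assoc

variable (S T M N P : Type*) [Ring S] [Ring T] [AddCommGroup M] [Module Sᵐᵒᵖ M]
  [AddCommGroup N] [Module S N] [Module Tᵐᵒᵖ N] [SMulCommClass S Tᵐᵒᵖ N]
  [SMulCommClass Tᵐᵒᵖ S N] [AddCommGroup P] [Module T P]

/-- `(m ⊗ n) ⊗ p ↦ m ⊗ (n ⊗ p)`. -/
def assocHom : BTensor T (BTensor S M N) P →+ BTensor S M (BTensor T N P) :=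
  lift (AddMonoidHom.flip (AddMonoidHom.mk' (fun p => lift
      ((mkHom S M (BTensor T N P)).compl₂ ((mkHom T N P).flip p))
      (fun m s n => by
        simpa using smul_tmul (S := S) m s (tmul T n p)))
      (fun p p' => hom_ext fun m n => by simp [tmul_add])))
    (fun x t p => by
      induction x using induction_on with
      | zero => simp
      | tmul m n => simp [smul_tmul]
      | add x y hx hy => simp only [smul_add, map_add, AddMonoidHom.add_apply, hx, hy])

/-- `m ⊗ (n ⊗ p) ↦ (m ⊗ n) ⊗ p`. -/
def assocInv : BTensor S M (BTensor T N P) →+ BTensor T (BTensor S M N) P :=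
  lift (AddMonoidHom.mk' (fun m => lift
      ((mkHom T (BTensor S M N) P).comp (mkHom S M N m))
      (fun n t p => by
        simpa using smul_tmul (S := T) (tmul S m n) t p))
      (fun m m' => hom_ext fun n p => by simp))
    (fun m s x => by
      induction x using induction_on with
      | zero => simp
      | tmul n p => simp [smul_tmul]
      | add x y hx hy => simp only [smul_add, map_add, hx, hy])

variable {S T M N P}

@[simp]
theorem assocHom_tmul (m : M) (n : N) (p : P) :
    assocHom S T M N P (tmul T (tmul S m n) p) = tmul S m (tmul T n p) := rfl

@[simp]
theorem assocInv_tmul (m : M) (n : N) (p : P) :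
    assocInv S T M N P (tmul S m (tmul T n p)) = tmul T (tmul S m n) p := rfl

theorem hom_ext₃ {Q : Type*} [AddCommGroup Q] {f g : BTensor T (BTensor S M N) P →+ Q}
    (h : ∀ m n p, f (tmul T (tmul S m n) p) = g (tmul T (tmul S m n) p)) : f = g :=
  hom_ext fun x p => by
    induction x using induction_on with
    | zero =>
      have h0 : tmul T (0 : BTensor S M N) p = 0 :=
        DFunLike.congr_fun (map_zero (mkHom T (BTensor S M N) P)) p
      simp [h0]
    | tmul m n => exact h m n p
    | add x y hx hy => simp only [add_tmul, map_add, hx, hy]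

theorem hom_ext₃' {Q : Type*} [AddCommGroup Q] {f g : BTensor S M (BTensor T N P) →+ Q}
    (h : ∀ m n p, f (tmul S m (tmul T n p)) = g (tmul S m (tmul T n p))) : f = g :=
  hom_ext fun m x => by
    induction x using induction_on with
    | zero =>
      have h0 : tmul S m (0 : BTensor T N P) = 0 := map_zero (mkHom S M (BTensor T N P) m)
      simp [h0]
    | tmul n p => exact h m n p
    | add x y hx hy => simp only [tmul_add, map_add, hx, hy]

variable (S T M N P)

/-- The associativity isomorphism `(M ⊗_S N) ⊗_T P ≅ M ⊗_S (N ⊗_T P)`. -/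
def assoc : BTensor T (BTensor S M N) P ≃+ BTensor S M (BTensor T N P) :=
  AddMonoidHom.toAddEquiv (assocHom S T M N P) (assocInv S T M N P)
    (hom_ext₃ fun _ _ _ => rfl) (hom_ext₃' fun _ _ _ => rfl)

variable {S T M N P}

@[simp]
theorem assoc_tmul (m : M) (n : N) (p : P) :
    assoc S T M N P (tmul T (tmul S m n) p) = tmul S m (tmul T n p) := rfl

end Assoc

end BTensor

end Tensor

/-! ### Corings and comodules -/

section Coring

/-- `(A,A)`-bimodule maps. -/
structure BimoduleHom (A M N : Type*) [Ring A] [AddCommGroup M] [Module A M] [Module Aᵐᵒᵖ M]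
    [AddCommGroup N] [Module A N] [Module Aᵐᵒᵖ N] extends M →ₗ[A] N where
  map_op_smul : ∀ (a : A) (m : M), toFun (op a • m) = op a • toFun m

/-- The right `A`-linear map underlying a bimodule map. -/
def BimoduleHom.right {A M N : Type*} [Ring A] [AddCommGroup M] [Module A M] [Module Aᵐᵒᵖ M]
    [AddCommGroup N] [Module A N] [Module Aᵐᵒᵖ N] (f : BimoduleHom A M N) : M →ₗ[Aᵐᵒᵖ] N where
  toFun := f.toLinearMap
  map_add' := map_add f.toLinearMap
  map_smul' a m := f.map_op_smul a.unop m

/-- The left `A`-linear map underlying a bimodule map. -/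
abbrev BimoduleHom.left {A M N : Type*} [Ring A] [AddCommGroup M] [Module A M] [Module Aᵐᵒᵖ M]
    [AddCommGroup N] [Module A N] [Module Aᵐᵒᵖ N] (f : BimoduleHom A M N) : M →ₗ[A] N :=
  f.toLinearMap

open BTensor

/-- An `A`-coring structure on the `(A,A)`-bimodule `C`. -/
structure Coring (A C : Type*) [Ring A] [AddCommGroup C] [Module A C] [Module Aᵐᵒᵖ C]
    [SMulCommClass A Aᵐᵒᵖ C] [SMulCommClass Aᵐᵒᵖ A C] where
  /-- the coproduct `Δ : C → C ⊗_A C` -/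
  comul : BimoduleHom A C (BTensor A C C)
  /-- the counit `ε : C → A` -/
  counit : BimoduleHom A C A
  coassoc : ∀ c : C, assoc A A C C C (map comul.right LinearMap.id (comul.left c)) =
    map LinearMap.id comul.left (comul.left c)
  counit_left : ∀ c : C, lid A C (map counit.right LinearMap.id (comul.left c)) = c
  counit_right : ∀ c : C, rid A C (map LinearMap.id counit.left (comul.left c)) = c

universe v

variable {A C : Type v} [Ring A] [AddCommGroup C] [Module A C] [Module Aᵐᵒᵖ C]
    [SMulCommClass A Aᵐᵒᵖ C] [SMulCommClass Aᵐᵒᵖ A C]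

/-- A right comodule of the coring `𝒞`. -/
structure RightComodule (𝒞 : Coring A C) where
  /-- the underlying right `A`-module -/
  carrier : Type v
  [addCommGroup : AddCommGroup carrier]
  [module : Module Aᵐᵒᵖ carrier]
  /-- the coaction `ρ : M → M ⊗_A C` -/
  coact : carrier →ₗ[Aᵐᵒᵖ] BTensor A carrier C
  coassoc : ∀ m : carrier, assoc A A carrier C C (map coact LinearMap.id (coact m)) =
    map LinearMap.id 𝒞.comul.left (coact m)
  counit : ∀ m : carrier, rid A carrier (map LinearMap.id 𝒞.counit.left (coact m)) = m

attribute [instance] RightComodule.addCommGroup RightComodule.module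

namespace RightComodule

variable {𝒞 : Coring A C}

/-- A morphism of right comodules: a colinear right `A`-module map. -/
@[ext]
structure Hom (M N : RightComodule 𝒞) where
  /-- the underlying right `A`-linear map -/
  toLin : M.carrier →ₗ[Aᵐᵒᵖ] N.carrier
  colinear : ∀ m : M.carrier,
    N.coact (toLin m) = map toLin LinearMap.id (M.coact m)

/-- The category of right `𝒞`-comodules. -/
instance : Category (RightComodule 𝒞) where
  Hom := Hom
  id M := ⟨LinearMap.id, fun m => (DFunLike.congr_fun (f := AddMonoidHom.id _)
    (g := map LinearMap.id LinearMap.id) (hom_ext fun _ _ => rfl) (M.coact m))⟩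
  comp {M N P} f g := ⟨g.toLin ∘ₗ f.toLin, fun m => by
    rw [LinearMap.comp_apply, g.colinear, f.colinear]
    exact DFunLike.congr_fun (f := (map g.toLin LinearMap.id).comp (map f.toLin LinearMap.id))
      (g := map (g.toLin ∘ₗ f.toLin) LinearMap.id) (hom_ext fun _ _ => rfl) (M.coact m)⟩

/-- The forgetful functor from right `𝒞`-comodules to right `A`-modules. -/
def forget (𝒞 : Coring A C) : RightComodule 𝒞 ⥤ ModuleCat.{v} Aᵐᵒᵖ where
  obj M := ModuleCat.of Aᵐᵒᵖ M.carrier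
  map f := ModuleCat.ofHom (Hom.toLin f)

end RightComodule

/-- A functor is Frobenius if one functor is both its right and its left adjoint. -/
def IsFrobeniusFunctor {X Y : Type*} [Category X] [Category Y] (F : X ⥤ Y) : Prop :=
  ∃ G : Y ⥤ X, Nonempty (F ⊣ G) ∧ Nonempty (G ⊣ F)

/-- A coring is Frobenius if the forgetful functor from its right comodules to right
`A`-modules is a Frobenius functor. -/
def Coring.IsFrobenius (𝒞 : Coring A C) : Prop :=
  IsFrobeniusFunctor (RightComodule.forget 𝒞)

end Coring

/-! ### Ring extensions -/

section Extension

variable {B A : Type*} [Ring B] [Ring A]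

/-- The ring `A`, as a bimodule over itself and, by restriction along `f : B → A`,
as a bimodule over `B`. -/
def Ext (_f : B →+* A) : Type _ := A

namespace Ext

variable (f : B →+* A)

instance : AddCommGroup (Ext f) := inferInstanceAs (AddCommGroup A)
instance : Module A (Ext f) := inferInstanceAs (Module A A)
instance : Module Aᵐᵒᵖ (Ext f) := inferInstanceAs (Module Aᵐᵒᵖ A)
instance : Module B (Ext f) := Module.compHom A f
instance : Module Bᵐᵒᵖ (Ext f) := Module.compHom A f.op

instance : SMulCommClass A Aᵐᵒᵖ (Ext f) := inferInstanceAs (SMulCommClass A Aᵐᵒᵖ A)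
instance : SMulCommClass Aᵐᵒᵖ A (Ext f) := inferInstanceAs (SMulCommClass Aᵐᵒᵖ A A)
instance : SMulCommClass A Bᵐᵒᵖ (Ext f) :=
  ⟨fun a b x => smul_comm (M := A) (N := Aᵐᵒᵖ) (α := A) a (f.op b) x⟩
instance : SMulCommClass Aᵐᵒᵖ B (Ext f) :=
  ⟨fun a b x => smul_comm (M := Aᵐᵒᵖ) (N := A) (α := A) a (f b) x⟩

/-- An element of `A` as an element of `Ext f`. -/
def of (a : A) : Ext f := a

variable {f} in
/-- An element of `Ext f` as an element of `A`. -/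
def val (x : Ext f) : A := x

@[simp] theorem val_of (a : A) : (of f a).val = a := rfl
@[simp] theorem of_val (x : Ext f) : of f x.val = x := rfl
@[simp] theorem smul_of (a x : A) : a • of f x = of f (a * x) := rfl
@[simp] theorem op_smul_of (a x : A) : op a • of f x = of f (x * a) := rfl
@[simp] theorem base_smul_of (b : B) (x : A) : b • of f x = of f (f b * x) := rfl
@[simp] theorem base_op_smul_of (b : B) (x : A) : op b • of f x = of f (x * f b) := rfl
@[simp] theorem val_smul (a : A) (x : Ext f) : (a • x).val = a * x.val := rfl
@[simp] theorem val_op_smul (a : A) (x : Ext f) : (op a • x).val = x.val * a := rfl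
@[simp] theorem val_base_smul (b : B) (x : Ext f) : (b • x).val = f b * x.val := rfl
@[simp] theorem val_base_op_smul (b : B) (x : Ext f) : (op b • x).val = x.val * f b := rfl

end Ext

/-- `f : B → A` is a Frobenius extension (of the first kind): `A` is a finitely generated
projective right `B`-module, and `A ≅ Hom_B(A, B)` (right `B`-linear maps) as
`(B,A)`-bimodules, where `(b φ)(y) = b φ(y)` and `(φ a)(y) = φ(ay)`. -/
def IsFrobeniusExtension (f : B →+* A) : Prop :=
  Module.Finite Bᵐᵒᵖ (Ext f) ∧ Module.Projective Bᵐᵒᵖ (Ext f) ∧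
    ∃ e : Ext f ≃+ (Ext f →ₗ[Bᵐᵒᵖ] B),
      (∀ (b : B) (x y : Ext f), e (b • x) y = b * e x y) ∧
      (∀ (x : Ext f) (a : A) (y : Ext f), e (op a • x) y = e x (a • y))

open BTensor

/-- The counit `A ⊗_B A → A`, `a ⊗ a' ↦ aa'`. -/
def sweedlerCounit (f : B →+* A) : BimoduleHom A (BTensor B (Ext f) (Ext f)) A where
  toFun := lift (M := Ext f) (N := Ext f) (P := A) (AddMonoidHom.mul (R := A))
    (fun m s n => mul_assoc (Ext.val m) (f s) (Ext.val n))
  map_add' := map_add _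
  map_smul' a x := by
    induction x using induction_on with
    | zero => simp
    | tmul m n => exact mul_assoc a (Ext.val m) (Ext.val n)
    | add x y hx hy => simp only [smul_add, map_add, hx, hy]
  map_op_smul a x := by
    induction x using induction_on with
    | zero => simp
    | tmul m n => exact (mul_assoc (Ext.val m) (Ext.val n) a).symm
    | add x y hx hy => simp only [smul_add, map_add, hx, hy]

/-- The coproduct `A ⊗_B A → (A ⊗_B A) ⊗_A (A ⊗_B A)`, `a ⊗ a' ↦ (a ⊗ 1) ⊗ (1 ⊗ a')`. -/
def sweedlerComul (f : B →+* A) : BimoduleHom A (BTensor B (Ext f) (Ext f))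
    (BTensor A (BTensor B (Ext f) (Ext f)) (BTensor B (Ext f) (Ext f))) where
  toFun := lift
    (((mkHom A (BTensor B (Ext f) (Ext f)) (BTensor B (Ext f) (Ext f))).comp
      ((mkHom B (Ext f) (Ext f)).flip (Ext.of f 1))).compl₂
        (mkHom B (Ext f) (Ext f) (Ext.of f 1)))
    (fun m s n => by
      have h₁ : tmul B (op s • m) (Ext.of f 1) = op (f s) • tmul B m (Ext.of f 1) := by
        rw [smul_tmul, right_smul_tmul]; simp
      have h₂ : tmul B (Ext.of f 1) (s • n) = f s • tmul B (Ext.of f 1) n := by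
        rw [← smul_tmul, left_smul_tmul]; simp
      change tmul A (tmul B (op s • m) (Ext.of f 1)) (tmul B (Ext.of f 1) n) =
        tmul A (tmul B m (Ext.of f 1)) (tmul B (Ext.of f 1) (s • n))
      rw [h₁, h₂, smul_tmul (S := A)])
  map_add' := map_add _
  map_smul' a x := by
    induction x using induction_on with
    | zero => simp
    | tmul m n => rfl
    | add x y hx hy => simp only [smul_add, map_add, hx, hy]
  map_op_smul a x := by
    induction x using induction_on with
    | zero => simp
    | tmul m n => rfl
    | add x y hx hy => simp only [smul_add, map_add, hx, hy]

theorem sweedlerComul_tmul (f : B →+* A) (x y : Ext f) :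
    (sweedlerComul f).left (tmul B x y) =
      tmul A (tmul B x (Ext.of f 1)) (tmul B (Ext.of f 1) y) := rfl

theorem sweedlerCounit_tmul (f : B →+* A) (x y : Ext f) :
    (sweedlerCounit f).left (tmul B x y) = x.val * y.val := rfl

/-- Sweedler's coring `A ⊗_B A` associated to `f : B → A`. -/
def sweedlerCoring (f : B →+* A) : Coring A (BTensor B (Ext f) (Ext f)) where
  comul := sweedlerComul f
  counit := sweedlerCounit f
  coassoc c := by
    induction c using induction_on with
    | zero => simp
    | tmul x y => rfl
    | add x y hx hy => simp only [map_add, hx, hy]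
  counit_left c := by
    induction c using induction_on with
    | zero => simp
    | tmul x y =>
      rw [sweedlerComul_tmul, map_tmul, lid_tmul]
      change (x.val * 1) • tmul B (Ext.of f 1) y = _
      rw [mul_one, left_smul_tmul, Ext.smul_of, mul_one, Ext.of_val]
    | add x y hx hy => simp only [map_add, hx, hy]
  counit_right c := by
    induction c using induction_on with
    | zero => simp
    | tmul x y =>
      rw [sweedlerComul_tmul, map_tmul, rid_tmul]
      change op (1 * y.val) • tmul B x (Ext.of f 1) = _
      rw [one_mul, right_smul_tmul, Ext.op_smul_of, one_mul, Ext.of_val]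
    | add x y hx hy => simp only [map_add, hx, hy]

end Extension

/-! ### Faithful flatness over a noncommutative ring -/

section FaithfullyFlat

universe w u v

/-- The left `B`-module `N` is faithfully flat: `- ⊗_B N` preserves and reflects exactness of
sequences `M₁ → M₂ → M₃` of right `B`-modules (in `Type w`). -/
def IsFaithfullyFlatLeft (B : Type u) (N : Type v) [Ring B] [AddCommGroup N] [Module B N] :
    Prop :=
  ∀ (M₁ M₂ M₃ : Type w) [AddCommGroup M₁] [AddCommGroup M₂] [AddCommGroup M₃]
    [Module Bᵐᵒᵖ M₁] [Module Bᵐᵒᵖ M₂] [Module Bᵐᵒᵖ M₃]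
    (g : M₁ →ₗ[Bᵐᵒᵖ] M₂) (h : M₂ →ₗ[Bᵐᵒᵖ] M₃),
    Function.Exact g h ↔
      Function.Exact (BTensor.map g (LinearMap.id : N →ₗ[B] N))
        (BTensor.map h (LinearMap.id : N →ₗ[B] N))

/-- The right `B`-module `M` is faithfully flat: `M ⊗_B -` preserves and reflects exactness of
sequences `N₁ → N₂ → N₃` of left `B`-modules (in `Type w`). -/
def IsFaithfullyFlatRight (B : Type u) (M : Type v) [Ring B] [AddCommGroup M]
    [Module Bᵐᵒᵖ M] : Prop :=
  ∀ (N₁ N₂ N₃ : Type w) [AddCommGroup N₁] [AddCommGroup N₂] [AddCommGroup N₃]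
    [Module B N₁] [Module B N₂] [Module B N₃]
    (g : N₁ →ₗ[B] N₂) (h : N₂ →ₗ[B] N₃),
    Function.Exact g h ↔
      Function.Exact (BTensor.map (LinearMap.id : M →ₗ[Bᵐᵒᵖ] M) g)
        (BTensor.map (LinearMap.id : M →ₗ[Bᵐᵒᵖ] M) h)

end FaithfullyFlat

end NC

namespace NC

open BTensor

/-! ### Cofree comodules and the right adjoint of the forgetful functor -/

section

namespace BTensor

/-! Both Frobenius conditions are equivalent to elementary data, and for the Sweedler coring the two
kinds of data are compared directly.

For any coring `C`, the functor `- ⊗_A C` is right adjoint to the forgetful functor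
(`forgetAdjCofree`). Right adjoints are unique, so `C` is Frobenius exactly when this functor is
also left adjoint. By naturality such an adjunction is determined by its unit at `A` and its counit
at `C`, that is, by a central element `e` of `C` and a bimodule map `π : C ⊗_A C → A` subject to the
equations of `FrobeniusSystem`. The two directions are `FrobeniusSystem.isFrobenius` and
`IsFrobenius.nonempty_frobeniusSystem`.

Likewise, a Frobenius extension amounts to a `B`-bimodule map `E : A → B` with dual bases `xᵢ, yᵢ`
(`IsFrobeniusExtension.nonempty_system`, `isFrobeniusExtension`). Such a system yields `e = ∑ xᵢ ⊗
yᵢ` and `π((a ⊗ b) ⊗ (c ⊗ d)) = a E(bc) d` (`sweedlerSystem`).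

Conversely, a system `(e, π)` of the Sweedler coring gives `E(a) = π((1 ⊗ a) ⊗ (1 ⊗ 1))`, a priori
with values in `A`. The equation relating `π` and `Δ` forces `E(a) ⊗ 1 = 1 ⊗ E(a)` (`tmul_endo`).
Faithfully flat descent identifies `B` with the elements having this property, so `E` takes values
in `B`, and any expression of `e` as a sum of pure tensors provides the dual bases. -/

@[simp]
theorem tmul_zero {S M N : Type*} [Ring S] [AddCommGroup M] [Module Sᵐᵒᵖ M]
    [AddCommGroup N] [Module S N] (m : M) : tmul S m (0 : N) = 0 :=
  map_zero (mkHom S M N m)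

@[simp]
theorem zero_tmul {S M N : Type*} [Ring S] [AddCommGroup M] [Module Sᵐᵒᵖ M]
    [AddCommGroup N] [Module S N] (n : N) : tmul S (0 : M) n = 0 :=
  DFunLike.congr_fun (map_zero (mkHom S M N)) n

section

variable {A M N M' N' : Type*} [Ring A] [AddCommGroup M] [Module Aᵐᵒᵖ M]
  [AddCommGroup N] [Module A N] [AddCommGroup M'] [Module Aᵐᵒᵖ M']
  [AddCommGroup N'] [Module A N'] [Module Aᵐᵒᵖ N] [SMulCommClass Aᵐᵒᵖ A N]
  [Module Aᵐᵒᵖ N'] [SMulCommClass Aᵐᵒᵖ A N']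

/-- The right linear map `f ⊗ g`, for `f` right linear and `g` a bimodule map. -/
def mapRight (f : M →ₗ[Aᵐᵒᵖ] M') (g : BimoduleHom A N N') :
    BTensor A M N →ₗ[Aᵐᵒᵖ] BTensor A M' N' where
  toFun := map f g.left
  map_add' := map_add _
  map_smul' a x := by
    induction x using induction_on with
    | zero => simp
    | tmul m n =>
      have : g.left (a • n) = a • g.left n := g.map_op_smul a.unop n
      simp [this]
    | add x y hx hy => simp only [smul_add, map_add, hx, hy]

@[simp]
theorem mapRight_apply (f : M →ₗ[Aᵐᵒᵖ] M') (g : BimoduleHom A N N') (x : BTensor A M N) :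
    mapRight f g x = map f g.left x := rfl

end

end BTensor

/-- The identity bimodule map. -/
def BimoduleHom.id (A M : Type*) [Ring A] [AddCommGroup M] [Module A M] [Module Aᵐᵒᵖ M] :
    BimoduleHom A M M where
  toLinearMap := LinearMap.id
  map_op_smul _ _ := rfl

@[simp]
theorem BimoduleHom.left_id (A M : Type*) [Ring A] [AddCommGroup M] [Module A M]
    [Module Aᵐᵒᵖ M] : (BimoduleHom.id A M).left = LinearMap.id := rfl

@[simp]
theorem BimoduleHom.right_apply {A M N : Type*} [Ring A] [AddCommGroup M] [Module A M]
    [Module Aᵐᵒᵖ M] [AddCommGroup N] [Module A N] [Module Aᵐᵒᵖ N] (f : BimoduleHom A M N)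
    (m : M) : f.right m = f.left m := rfl

universe v

variable {A C : Type v} [Ring A] [AddCommGroup C] [Module A C] [Module Aᵐᵒᵖ C]
    [SMulCommClass A Aᵐᵒᵖ C] [SMulCommClass Aᵐᵒᵖ A C]

namespace RightComodule

variable {𝒞 : Coring A C}

theorem hom_ext' {M N : RightComodule 𝒞} {f g : M ⟶ N}
    (h : ∀ m, Hom.toLin f m = Hom.toLin g m) : f = g :=
  Hom.ext (LinearMap.ext h)

/-- The coaction `n ⊗ c ↦ (n ⊗ c₁) ⊗ c₂` on `N ⊗_A C`. -/
def cofreeCoact (𝒞 : Coring A C) (N : Type v) [AddCommGroup N] [Module Aᵐᵒᵖ N] :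
    BTensor A N C →ₗ[Aᵐᵒᵖ] BTensor A (BTensor A N C) C where
  toFun x := assocInv A A N C C (map LinearMap.id 𝒞.comul.left x)
  map_add' x y := by simp only [map_add]
  map_smul' a x := by
    induction x using induction_on with
    | zero => simp
    | tmul m n =>
      have : 𝒞.comul.left (a • n) = a • 𝒞.comul.left n := 𝒞.comul.map_op_smul a.unop n
      simp only [right_smul_tmul, map_tmul, this, LinearMap.id_apply, RingHom.id_apply]
      generalize 𝒞.comul.left n = z
      induction z using induction_on with
      | zero => simp
      | tmul m n => simp
      | add x y hx hy => simp only [smul_add, map_add, tmul_add, hx, hy]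
    | add x y hx hy => simp only [smul_add, map_add, hx, hy]

theorem cofreeCoact_tmul (𝒞 : Coring A C) (N : Type v) [AddCommGroup N] [Module Aᵐᵒᵖ N]
    (n : N) (c : C) : cofreeCoact 𝒞 N (tmul A n c) =
      assocInv A A N C C (tmul A n (𝒞.comul.left c)) := rfl

/-- The cofree comodule `N ⊗_A C`. -/
abbrev cofreeObj (𝒞 : Coring A C) (N : Type v) [AddCommGroup N] [Module Aᵐᵒᵖ N] :
    RightComodule 𝒞 where
  carrier := BTensor A N C
  coact := cofreeCoact 𝒞 N
  coassoc x := by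
    induction x using induction_on with
    | zero => simp
    | tmul n c =>
      -- The factor `n` is carried along unchanged, so the claim reduces to coassociativity of the
      -- coring. An arbitrary `z` replaces `Δ(c)`, which need not be a pure tensor.
      have h₁ : ∀ z : BTensor A C C, assoc A A (BTensor A N C) C C
          (map (cofreeCoact 𝒞 N) LinearMap.id (assocInv A A N C C (tmul A n z))) =
          assocInv A A N C (BTensor A C C) (tmul A n (assoc A A C C C
            (map 𝒞.comul.right LinearMap.id z))) := by
        intro z
        induction z using induction_on with
        | zero => simp
        | tmul c d =>
          simp only [assocInv_tmul, map_tmul, cofreeCoact_tmul, BimoduleHom.right_apply]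
          generalize 𝒞.comul.left c = w
          induction w using induction_on with
          | zero => simp
          | tmul m n => simp
          | add x y hx hy => simp only [map_add, tmul_add, add_tmul, hx, hy]
        | add x y hx hy => simp only [map_add, tmul_add, hx, hy]
      have h₂ : ∀ z : BTensor A C C, map LinearMap.id 𝒞.comul.left
          (assocInv A A N C C (tmul A n z)) =
          assocInv A A N C (BTensor A C C) (tmul A n (map LinearMap.id 𝒞.comul.left z)) := by
        intro z
        induction z using induction_on with
        | zero => simp
        | tmul c d => simp
        | add x y hx hy => simp only [map_add, tmul_add, hx, hy]
      rw [cofreeCoact_tmul, h₁, h₂, 𝒞.coassoc]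
    | add x y hx hy => simp only [map_add, hx, hy]
  counit x := by
    induction x using induction_on with
    | zero => simp
    | tmul n c =>
      have h : ∀ z : BTensor A C C, rid A (BTensor A N C)
          (map LinearMap.id 𝒞.counit.left (assocInv A A N C C (tmul A n z))) =
          tmul A n (rid A C (map LinearMap.id 𝒞.counit.left z)) := by
        intro z
        induction z using induction_on with
        | zero => simp
        | tmul c d => simp
        | add x y hx hy => simp only [map_add, tmul_add, hx, hy]
      rw [cofreeCoact_tmul, h, 𝒞.counit_right]
    | add x y hx hy => simp only [map_add, hx, hy]

/-- The comodule map `f ⊗_A C`. -/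
def cofreeMap (𝒞 : Coring A C) {N N' : Type v} [AddCommGroup N] [Module Aᵐᵒᵖ N]
    [AddCommGroup N'] [Module Aᵐᵒᵖ N'] (f : N →ₗ[Aᵐᵒᵖ] N') :
    cofreeObj 𝒞 N ⟶ cofreeObj 𝒞 N' where
  toLin := mapRight f (BimoduleHom.id A C)
  colinear x := by
    induction x using induction_on with
    | zero => simp
    | tmul n c =>
      simp only [mapRight_apply, map_tmul, cofreeCoact_tmul, BimoduleHom.left_id,
        LinearMap.id_apply]
      generalize 𝒞.comul.left c = z
      induction z using induction_on with
      | zero => simp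
      | tmul c d => simp
      | add x y hx hy => simp only [map_add, tmul_add, hx, hy]
    | add x y hx hy => simp only [map_add, hx, hy]

/-- The functor `- ⊗_A C` from right `A`-modules to right `C`-comodules. -/
def cofree (𝒞 : Coring A C) : ModuleCat.{v} Aᵐᵒᵖ ⥤ RightComodule 𝒞 where
  obj N := cofreeObj 𝒞 N
  map f := cofreeMap 𝒞 f.hom
  map_id N := hom_ext' fun x => by
    induction x using induction_on with
    | zero => simp
    | tmul n c => rfl
    | add x y hx hy => simp only [map_add, hx, hy]
  map_comp f g := hom_ext' fun x => by
    induction x using induction_on with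
    | zero => simp
    | tmul n c => rfl
    | add x y hx hy => simp only [map_add, hx, hy]

/-- The coaction as a morphism of comodules. -/
def coactHom (M : RightComodule 𝒞) : M ⟶ cofreeObj 𝒞 M.carrier where
  toLin := M.coact
  colinear m := by
    apply (assoc A A M.carrier C C).injective
    refine Eq.trans ?_ (M.coassoc m).symm
    exact (assoc A A M.carrier C C).apply_symm_apply _

/-- The map `n ⊗ c ↦ n ε(c)`. -/
def cofreeCounit (𝒞 : Coring A C) (N : Type v) [AddCommGroup N] [Module Aᵐᵒᵖ N] :
    BTensor A N C →ₗ[Aᵐᵒᵖ] N where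
  toFun x := rid A N (map LinearMap.id 𝒞.counit.left x)
  map_add' x y := by simp only [map_add]
  map_smul' a x := by
    induction x using induction_on with
    | zero => simp
    | tmul m n =>
      have : 𝒞.counit.left (a • n) = a • 𝒞.counit.left n := 𝒞.counit.map_op_smul a.unop n
      simp [this, mul_smul]
    | add x y hx hy => simp only [smul_add, map_add, hx, hy]

@[simp]
theorem cofreeCounit_tmul (𝒞 : Coring A C) (N : Type v) [AddCommGroup N] [Module Aᵐᵒᵖ N]
    (n : N) (c : C) : cofreeCounit 𝒞 N (tmul A n c) = op (𝒞.counit.left c) • n := rfl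

/-- The functor `- ⊗_A C` is right adjoint to the forgetful functor. -/
def forgetAdjCofree (𝒞 : Coring A C) : forget 𝒞 ⊣ cofree 𝒞 where
  unit :=
    { app := fun M => coactHom M
      naturality := fun M N f => hom_ext' fun m => Hom.colinear f m }
  counit :=
    { app := fun N => ModuleCat.ofHom (cofreeCounit 𝒞 N)
      naturality := fun N N' f => by
        ext x
        change cofreeCounit 𝒞 N' (map f.hom LinearMap.id x) = f.hom (cofreeCounit 𝒞 N x)
        induction x using induction_on with
        | zero => simp
        | tmul n c => simp
        | add x y hx hy => simp only [map_add, hx, hy] }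
  left_triangle_components M := by
    ext m
    exact M.counit m
  right_triangle_components N := hom_ext' fun x => by
    change map (cofreeCounit 𝒞 N) LinearMap.id (cofreeCoact 𝒞 N x) = x
    induction x using induction_on with
    | zero => simp
    | tmul n c =>
      have h : ∀ z : BTensor A C C, map (cofreeCounit 𝒞 N) LinearMap.id
          (assocInv A A N C C (tmul A n z)) =
          tmul A n (lid A C (map 𝒞.counit.right LinearMap.id z)) := by
        intro z
        induction z using induction_on with
        | zero => simp
        | tmul c d => simp [smul_tmul]
        | add x y hx hy => simp only [map_add, tmul_add, hx, hy]
      rw [cofreeCoact_tmul, h, 𝒞.counit_left]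
    | add x y hx hy => simp only [map_add, hx, hy]

end RightComodule

end

/-! ### Frobenius systems of a coring and the second adjunction -/

section

universe v

variable {A C : Type v} [Ring A] [AddCommGroup C] [Module A C] [Module Aᵐᵒᵖ C]
    [SMulCommClass A Aᵐᵒᵖ C] [SMulCommClass Aᵐᵒᵖ A C]

namespace Coring

/-- A Frobenius system of a coring: a central element `e` and a bimodule map
`π : C ⊗_A C → A` with `c₁ π(c₂ ⊗ c') = π(c ⊗ c'₁) c'₂` and `π(c ⊗ e) = ε(c) = π(e ⊗ c)`. -/
structure FrobeniusSystem (𝒞 : Coring A C) where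
  /-- the central element -/
  elt : C
  /-- the bimodule map -/
  form : BimoduleHom A (BTensor A C C) A
  central : ∀ a : A, a • elt = op a • elt
  form_comul : ∀ c d : C,
    rid A C (map LinearMap.id form.left (assoc A A C C C (tmul A (𝒞.comul.left c) d))) =
      lid A C (map form.right LinearMap.id (assocInv A A C C C (tmul A c (𝒞.comul.left d))))
  form_elt : ∀ c : C, form.left (tmul A c elt) = 𝒞.counit.left c
  elt_form : ∀ c : C, form.left (tmul A elt c) = 𝒞.counit.left c

variable {𝒞 : Coring A C}

open RightComodule

namespace FrobeniusSystem

variable (s : FrobeniusSystem 𝒞)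

/-- The map `n ↦ n ⊗ e`. -/
def unit (N : Type v) [AddCommGroup N] [Module Aᵐᵒᵖ N] : N →ₗ[Aᵐᵒᵖ] BTensor A N C where
  toFun n := tmul A n s.elt
  map_add' := fun m n => add_tmul m n _
  map_smul' a n := by
    have := smul_tmul n a.unop s.elt
    rw [s.central] at this
    simpa using this

@[simp]
theorem unit_apply (N : Type v) [AddCommGroup N] [Module Aᵐᵒᵖ N] (n : N) :
    s.unit N n = tmul A n s.elt := rfl

/-- The map `(m ⊗ c) ⊗ d ↦ m π(c ⊗ d)`. -/
def act (M : Type v) [AddCommGroup M] [Module Aᵐᵒᵖ M] :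
    BTensor A (BTensor A M C) C →ₗ[Aᵐᵒᵖ] M where
  toFun x := rid A M (map LinearMap.id s.form.left (assoc A A M C C x))
  map_add' x y := by simp only [map_add]
  map_smul' a x := by
    induction x using induction_on with
    | zero => simp
    | tmul y d =>
      induction y using induction_on with
      | zero => simp
      | tmul m c =>
        have : s.form.left (a • tmul A c d) = a • s.form.left (tmul A c d) :=
          s.form.map_op_smul a.unop _
        rw [right_smul_tmul] at this
        simp [this, mul_smul]
      | add x y hx hy => simp only [smul_add, map_add, add_tmul, hx, hy]
    | add x y hx hy => simp only [smul_add, map_add, hx, hy]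

@[simp]
theorem act_tmul (M : Type v) [AddCommGroup M] [Module Aᵐᵒᵖ M] (m : M) (c d : C) :
    s.act M (tmul A (tmul A m c) d) = op (s.form.left (tmul A c d)) • m := rfl

/-- The map `m ⊗ c ↦ m₀ π(m₁ ⊗ c)` as a right linear map. -/
def counitLin (M : RightComodule 𝒞) : BTensor A M.carrier C →ₗ[Aᵐᵒᵖ] M.carrier :=
  s.act M.carrier ∘ₗ mapRight M.coact (BimoduleHom.id A C)

theorem counitLin_tmul (M : RightComodule 𝒞) (m : M.carrier) (c : C) :
    s.counitLin M (tmul A m c) = s.act M.carrier (tmul A (M.coact m) c) := rfl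

/-- The values of `π` act as scalars, and the coaction is right `A`-linear. -/
theorem coact_act (M : RightComodule 𝒞) (z : BTensor A M.carrier C) (d : C) :
    M.coact (s.act M.carrier (tmul A z d)) =
      s.act (BTensor A M.carrier C) (tmul A (map M.coact LinearMap.id z) d) := by
  induction z using induction_on with
  | zero => simp
  | tmul m c => simp only [act_tmul, map_smul, map_tmul, LinearMap.id_apply]
  | add x y hx hy => simp only [map_add, add_tmul, hx, hy]

theorem act_assocInv (N : Type v) [AddCommGroup N] [Module Aᵐᵒᵖ N] (n : N)
    (z : BTensor A C C) (d : C) :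
    s.act (BTensor A N C) (tmul A (assocInv A A N C C (tmul A n z)) d) =
      tmul A n (rid A C (map LinearMap.id s.form.left (assoc A A C C C (tmul A z d)))) := by
  induction z using induction_on with
  | zero => simp
  | tmul b c => simp
  | add x y hx hy => simp only [map_add, add_tmul, tmul_add, hx, hy]

theorem map_act_assocInv (N : Type v) [AddCommGroup N] [Module Aᵐᵒᵖ N] (n : N) (c : C)
    (z : BTensor A C C) :
    map (s.act N) LinearMap.id (assocInv A A (BTensor A N C) C C (tmul A (tmul A n c) z)) =
      tmul A n (lid A C (map s.form.right LinearMap.id (assocInv A A C C C (tmul A c z)))) := by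
  induction z using induction_on with
  | zero => simp
  | tmul b c => simp [smul_tmul]
  | add x y hx hy => simp only [map_add, tmul_add, hx, hy]

theorem map_counitLin_assocInv (M : RightComodule 𝒞) (m : M.carrier) (z : BTensor A C C) :
    map (s.counitLin M) LinearMap.id (assocInv A A M.carrier C C (tmul A m z)) =
      map (s.act M.carrier) LinearMap.id
        (assocInv A A (BTensor A M.carrier C) C C (tmul A (M.coact m) z)) := by
  induction z using induction_on with
  | zero => simp
  | tmul b c => rfl
  | add x y hx hy => simp only [map_add, tmul_add, hx, hy]

/-- Coassociativity of `M`, solved for the left-bracketed tensor. -/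
theorem map_coact_coact (M : RightComodule 𝒞) (m : M.carrier) :
    map M.coact LinearMap.id (M.coact m) =
      assocInv A A M.carrier C C (map LinearMap.id 𝒞.comul.left (M.coact m)) := by
  rw [← M.coassoc]
  exact ((assoc A A M.carrier C C).symm_apply_apply _).symm

/-- The morphism of comodules `M ⊗_A C → M`, `m ⊗ c ↦ m₀ π(m₁ ⊗ c)`. -/
def counit (M : RightComodule 𝒞) : cofreeObj 𝒞 M.carrier ⟶ M where
  toLin := s.counitLin M
  colinear x := by
    induction x using induction_on with
    | zero => simp only [map_zero]
    | tmul m d =>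
      -- In Sweedler notation, `ρ(m₀ π(m₁ ⊗ d)) = m₀ ⊗ m₁ π(m₂ ⊗ d) = m₀ ⊗ π(m₁ ⊗ d₁) d₂`: linearity
      -- and coassociativity, then `form_comul`.
      rw [counitLin_tmul, coact_act, map_coact_coact]
      refine Eq.trans ?_ (s.map_counitLin_assocInv M m (𝒞.comul.left d)).symm
      generalize M.coact m = z
      induction z using induction_on with
      | zero => simp
      | tmul m c =>
        rw [map_tmul, act_assocInv, map_act_assocInv, form_comul]
        rfl
      | add x y hx hy => simp only [map_add, add_tmul, hx, hy]
    | add x y hx hy => simp only [map_add, hx, hy]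

/-- A triangle identity: `n ⊗ e₁ π(e₂ ⊗ c) = n ⊗ π(e ⊗ c₁) c₂ = n ⊗ ε(c₁) c₂ = n ⊗ c`. -/
theorem counitLin_cofreeObj (N : Type v) [AddCommGroup N] [Module Aᵐᵒᵖ N]
    (x : BTensor A N C) :
    s.counitLin (cofreeObj 𝒞 N) (map (s.unit N) LinearMap.id x) = x := by
  induction x using induction_on with
  | zero => simp only [map_zero]
  | tmul n c =>
    have h : ∀ z : BTensor A C C, map s.form.right LinearMap.id
        (assocInv A A C C C (tmul A s.elt z)) = map 𝒞.counit.right LinearMap.id z := by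
      intro z
      induction z using induction_on with
      | zero => simp
      | tmul c d => simp [s.elt_form]
      | add x y hx hy => simp only [map_add, tmul_add, hx, hy]
    rw [map_tmul, counitLin_tmul, unit_apply, cofreeCoact_tmul, act_assocInv, form_comul, h,
      LinearMap.id_apply, 𝒞.counit_left]
  | add x y hx hy => simp only [map_add, hx, hy]

/-- The other triangle identity: `m₀ π(m₁ ⊗ e) = m₀ ε(m₁) = m`. -/
theorem counitLin_unit (M : RightComodule 𝒞) (m : M.carrier) :
    s.counitLin M (s.unit M.carrier m) = m := by
  have h : ∀ z : BTensor A M.carrier C, s.act M.carrier (tmul A z s.elt) =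
      rid A M.carrier (map LinearMap.id 𝒞.counit.left z) := by
    intro z
    induction z using induction_on with
    | zero => simp
    | tmul m c => simp [s.form_elt]
    | add x y hx hy => simp only [map_add, add_tmul, hx, hy]
  rw [unit_apply, counitLin_tmul, h, M.counit]

theorem counitLin_naturality {M N : RightComodule 𝒞} (f : M ⟶ N)
    (x : BTensor A M.carrier C) :
    s.counitLin N (map (Hom.toLin f) LinearMap.id x) = Hom.toLin f (s.counitLin M x) := by
  induction x using induction_on with
  | zero => simp
  | tmul m c =>
    simp only [map_tmul, counitLin_tmul, LinearMap.id_apply, Hom.colinear]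
    generalize M.coact m = z
    induction z using induction_on with
    | zero => simp
    | tmul m d => simp
    | add x y hx hy => simp only [map_add, add_tmul, hx, hy]
  | add x y hx hy => simp only [map_add, hx, hy]

/-- The functor `- ⊗_A C` is left adjoint to the forgetful functor. -/
def cofreeAdjForget : cofree 𝒞 ⊣ forget 𝒞 where
  unit :=
    { app := fun N => ModuleCat.ofHom (s.unit N)
      naturality := fun N N' f => by
        ext x
        rfl }
  counit :=
    { app := fun M => s.counit M
      naturality := fun M N f => hom_ext' fun x => s.counitLin_naturality f x }
  left_triangle_components N := hom_ext' fun x => by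
    change s.counitLin (cofreeObj 𝒞 N) (map (s.unit N) LinearMap.id x) = x
    exact s.counitLin_cofreeObj N x
  right_triangle_components M := by
    ext m
    exact s.counitLin_unit M m

theorem isFrobenius (s : FrobeniusSystem 𝒞) : 𝒞.IsFrobenius :=
  ⟨cofree 𝒞, ⟨forgetAdjCofree 𝒞⟩, ⟨s.cofreeAdjForget⟩⟩

end FrobeniusSystem

end Coring

end

/-! ### From a Frobenius coring to a Frobenius system -/

section

universe v

variable {A C : Type v} [Ring A] [AddCommGroup C] [Module A C] [Module Aᵐᵒᵖ C]
    [SMulCommClass A Aᵐᵒᵖ C] [SMulCommClass Aᵐᵒᵖ A C]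

open RightComodule

namespace RightComodule

/-- The coring as a right comodule over itself. -/
abbrev regular (𝒞 : Coring A C) : RightComodule 𝒞 where
  carrier := C
  coact := 𝒞.comul.right
  coassoc := 𝒞.coassoc
  counit := 𝒞.counit_right

variable {𝒞 : Coring A C}

/-- Left multiplication by `a` as an endomorphism of the regular comodule. -/
def regularSMul (𝒞 : Coring A C) (a : A) : regular 𝒞 ⟶ regular 𝒞 where
  toLin := DistribSMul.toLinearMap Aᵐᵒᵖ C a
  colinear c := by
    refine (map_smul 𝒞.comul.left a c).trans ?_
    rfl

/-- The morphism `c ↦ n ⊗ c` from the regular comodule to `N ⊗_A C`. -/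
def regularToCofree (𝒞 : Coring A C) {N : Type v} [AddCommGroup N] [Module Aᵐᵒᵖ N] (n : N) :
    regular 𝒞 ⟶ cofreeObj 𝒞 N where
  toLin :=
    { toFun := fun c => tmul A n c
      map_add' := tmul_add n
      map_smul' := fun _ _ => rfl }
  colinear c := by
    change assocInv A A N C C (tmul A n (𝒞.comul.left c)) = map _ _ (𝒞.comul.left c)
    generalize 𝒞.comul.left c = z
    induction z using induction_on with
    | zero => simp
    | tmul c d => rfl
    | add x y hx hy => simp only [map_add, tmul_add, hx, hy]

end RightComodule

namespace Coring

variable {𝒞 : Coring A C}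

/-- By uniqueness of right adjoints the given functor may be replaced by `- ⊗_A C`. The unit `η` and
counit `κ` of the resulting adjunction are unbundled so that naturality and the triangle identities
can be evaluated on elements. -/
theorem IsFrobenius.exists_unit_counit (h : 𝒞.IsFrobenius) :
    ∃ (η : ∀ (N : Type v) [AddCommGroup N] [Module Aᵐᵒᵖ N], N →ₗ[Aᵐᵒᵖ] BTensor A N C)
      (κ : ∀ M : RightComodule 𝒞, cofreeObj 𝒞 M.carrier ⟶ M),
      (∀ (N N' : Type v) [AddCommGroup N] [Module Aᵐᵒᵖ N] [AddCommGroup N'] [Module Aᵐᵒᵖ N']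
        (f : N →ₗ[Aᵐᵒᵖ] N') (n : N), η N' (f n) = map f LinearMap.id (η N n)) ∧
      (∀ (M M' : RightComodule 𝒞) (f : M ⟶ M') (x : BTensor A M.carrier C),
        Hom.toLin (κ M') (map (Hom.toLin f) LinearMap.id x) =
          Hom.toLin f (Hom.toLin (κ M) x)) ∧
      (∀ (M : RightComodule 𝒞) (m : M.carrier), Hom.toLin (κ M) (η M.carrier m) = m) ∧
      (∀ (N : Type v) [AddCommGroup N] [Module Aᵐᵒᵖ N] (x : BTensor A N C),
        Hom.toLin (κ (cofreeObj 𝒞 N)) (map (η N) LinearMap.id x) = x) := by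
  obtain ⟨G, ⟨adj₁⟩, ⟨adj₂⟩⟩ := h
  let adj : cofree 𝒞 ⊣ forget 𝒞 :=
    adj₂.ofNatIsoLeft (adj₁.rightAdjointUniq (forgetAdjCofree 𝒞))
  refine ⟨fun N _ _ => (adj.unit.app (ModuleCat.of Aᵐᵒᵖ N)).hom, fun M => adj.counit.app M,
    ?_, ?_, ?_, ?_⟩
  · intro N N' _ _ _ _ f n
    exact congr($(adj.unit.naturality (ModuleCat.ofHom f)).hom n)
  · intro M M' f x
    exact congr(Hom.toLin $(adj.counit.naturality f) x)
  · intro M m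
    exact congr($(adj.right_triangle_components M).hom m)
  · intro N _ _ x
    exact congr(Hom.toLin $(adj.left_triangle_components (ModuleCat.of Aᵐᵒᵖ N)) x)

/-- With `k` the counit at the regular comodule, the system is `e = η(1)`, read in `A ⊗_A C ≅ C`,
and `π = ε ∘ k`. Naturality along left multiplications makes `π` left `A`-linear; right linearity of
`η` makes `e` central. -/
theorem IsFrobenius.nonempty_frobeniusSystem (h : 𝒞.IsFrobenius) :
    Nonempty (FrobeniusSystem 𝒞) := by
  obtain ⟨η, κ, hη, hκ, tri₁, tri₂⟩ := h.exists_unit_counit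
  let k : BTensor A C C →ₗ[Aᵐᵒᵖ] C := Hom.toLin (κ (regular 𝒞))
  let e : C := lid A C (η A 1)
  have k_smul (a : A) (z : BTensor A C C) : k (a • z) = a • k z :=
    hκ _ _ (regularSMul 𝒞 a) z
  have k_cofree (N : Type v) [AddCommGroup N] [Module Aᵐᵒᵖ N] (n : N) (c d : C) :
      Hom.toLin (κ (cofreeObj 𝒞 N)) (tmul A (tmul A n c) d) = tmul A n (k (tmul A c d)) :=
    hκ _ _ (regularToCofree 𝒞 n) (tmul A c d)
  -- Naturality along `A → N`, `a ↦ na`, determines `η` from its value at `1`.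
  have η_apply (N : Type v) [AddCommGroup N] [Module Aᵐᵒᵖ N] (n : N) : η N n = tmul A n e := by
    let g : A →ₗ[Aᵐᵒᵖ] N :=
      { toFun := fun a => op a • n
        map_add' := fun a b => by rw [MulOpposite.op_add, add_smul]
        map_smul' := fun a b => by simp [mul_smul] }
    have hg : ∀ z : BTensor A A C, map g LinearMap.id z = tmul A n (lid A C z) := by
      intro z
      induction z using induction_on with
      | zero => simp
      | tmul a c => exact smul_tmul n a c
      | add x y hx hy => simp only [map_add, tmul_add, hx, hy]
    have := hη A N g 1
    rw [hg] at this
    simpa [g] using this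
  let π : BimoduleHom A (BTensor A C C) A :=
    { toFun := fun z => 𝒞.counit.left (k z)
      map_add' := fun x y => by simp only [map_add]
      map_smul' := fun a z => by rw [k_smul, map_smul]; rfl
      map_op_smul := fun a z => by rw [map_smul]; exact 𝒞.counit.map_op_smul a _ }
  have π_apply (z : BTensor A C C) : π.left z = 𝒞.counit.left (k z) := rfl
  have k_elt (c : C) : k (tmul A c e) = c := by
    rw [← η_apply]
    exact tri₁ (regular 𝒞) c
  have elt_k (c : C) : k (tmul A e c) = c := by
    have := congr(lid A C $(tri₂ A (tmul A 1 c)))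
    rw [map_tmul, η_apply, LinearMap.id_apply, k_cofree] at this
    simpa using this
  refine ⟨⟨e, π, fun a => ?_, fun c d => ?_, fun c => ?_, fun c => ?_⟩⟩
  · have h₁ := (η A).map_smul (op a) 1
    rw [η_apply, η_apply] at h₁
    simpa using congr(lid A C $h₁)
  -- Both sides equal `k(c ⊗ d)`: each is a counit law applied to `Δ(k(c ⊗ d))`. On the left this
  -- coproduct is computed by naturality of `κ` along `Δ`, on the right by colinearity of `k`.
  · trans k (tmul A c d)
    · have h₁ : 𝒞.comul.left (k (tmul A c d)) =
          Hom.toLin (κ (cofreeObj 𝒞 C)) (tmul A (𝒞.comul.left c) d) :=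
        (hκ _ _ (coactHom (regular 𝒞)) (tmul A c d)).symm
      have h₂ : ∀ z : BTensor A C C, rid A C (map LinearMap.id π.left
          (assoc A A C C C (tmul A z d))) = rid A C (map LinearMap.id 𝒞.counit.left
            (Hom.toLin (κ (cofreeObj 𝒞 C)) (tmul A z d))) := by
        intro z
        induction z using induction_on with
        | zero => simp
        | tmul b c => rw [k_cofree]; rfl
        | add x y hx hy => simp only [map_add, add_tmul, hx, hy]
      rw [h₂, ← h₁, 𝒞.counit_right]
    · have h₁ : 𝒞.comul.left (k (tmul A c d)) =
          map k LinearMap.id (assocInv A A C C C (tmul A c (𝒞.comul.left d))) :=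
        Hom.colinear (κ (regular 𝒞)) (tmul A c d)
      have h₂ : ∀ z : BTensor A (BTensor A C C) C, lid A C (map π.right LinearMap.id z) =
          lid A C (map 𝒞.counit.right LinearMap.id (map k LinearMap.id z)) := by
        intro z
        induction z using induction_on with
        | zero => simp
        | tmul b c => rfl
        | add x y hx hy => simp only [map_add, hx, hy]
      rw [h₂, ← h₁, 𝒞.counit_left]
  · rw [π_apply, k_elt]
  · rw [π_apply, elt_k]

end Coring

end

/-! ### Frobenius systems of ring extensions and of the Sweedler coring -/

section

universe u v

theorem BTensor.exists_eq_sum {S M N : Type*} [Ring S] [AddCommGroup M] [Module Sᵐᵒᵖ M]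
    [AddCommGroup N] [Module S N] (z : BTensor S M N) :
    ∃ (n : ℕ) (x : Fin n → M) (y : Fin n → N), z = ∑ i, tmul S (x i) (y i) := by
  induction z using induction_on with
  | zero => exact ⟨0, 0, 0, by simp⟩
  | tmul m n => exact ⟨1, fun _ => m, fun _ => n, by simp⟩
  | add z w hz hw =>
    obtain ⟨n, x, y, rfl⟩ := hz
    obtain ⟨m, x', y', rfl⟩ := hw
    exact ⟨n + m, Fin.append x x', Fin.append y y', by simp [Fin.sum_univ_add]⟩

variable {B : Type u} {A : Type v} [Ring B] [Ring A]

/-- A Frobenius system of a ring extension `f : B → A`: a `B`-bimodule map `E : A → B` together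
with dual bases `x`, `y`, that is, `∑ xᵢ E(yᵢ a) = a = ∑ E(a xᵢ) yᵢ`. -/
structure ExtensionFrobeniusSystem (f : B →+* A) where
  /-- the Frobenius homomorphism -/
  form : A →+ B
  form_left : ∀ b a, form (f b * a) = b * form a
  form_right : ∀ a b, form (a * f b) = form a * b
  /-- the number of elements of the dual bases -/
  card : ℕ
  /-- the first dual basis -/
  x : Fin card → A
  /-- the second dual basis -/
  y : Fin card → A
  sum_left : ∀ a, ∑ i, x i * f (form (y i * a)) = a
  sum_right : ∀ a, ∑ i, f (form (a * x i)) * y i = a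

variable {f : B →+* A}

/-- The Frobenius homomorphism is the image of `1` under `A ≅ Hom_B(A, B)`. A splitting of `Bⁿ → A`
gives a dual basis `xᵢ, φᵢ`, and `yᵢ` is the element representing `φᵢ`. -/
theorem IsFrobeniusExtension.nonempty_system (h : IsFrobeniusExtension f) :
    Nonempty (ExtensionFrobeniusSystem f) := by
  obtain ⟨_, _, e, he₁, he₂⟩ := h
  obtain ⟨n, p, q, -, -, hpq⟩ :=
    Module.Finite.exists_comp_eq_id_of_projective Bᵐᵒᵖ (Ext f)
  let φ (i : Fin n) : Ext f →ₗ[Bᵐᵒᵖ] B :=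
    { toFun := fun a => unop (q a i)
      map_add' := fun a b => by simp
      map_smul' := fun b a => by simp }
  let E : A →+ B := (e (Ext.of f 1)).toAddMonoidHom
  have hE (a b : A) : e (Ext.of f a) (Ext.of f b) = E (a * b) := by
    have := he₂ (Ext.of f 1) a (Ext.of f b)
    rw [Ext.op_smul_of, one_mul, Ext.smul_of] at this
    exact this
  let x (i : Fin n) : A := (p fun j => if i = j then 1 else 0).val
  let y (i : Fin n) : A := (e.symm (φ i)).val
  have hy (i : Fin n) (a : A) : E (y i * a) = unop (q (Ext.of f a) i) := by
    rw [← hE]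
    exact congr($(e.apply_symm_apply (φ i)) a)
  have hxy (a : A) : ∑ i, x i * f (E (y i * a)) = a := by
    have h := congr($hpq (Ext.of f a))
    rw [LinearMap.comp_apply, LinearMap.pi_apply_eq_sum_univ p (q (Ext.of f a))] at h
    simp only [hy]
    exact h
  have hleft (b : B) (a : A) : E (f b * a) = b * E a := by
    have := he₁ b (Ext.of f 1) (Ext.of f a)
    rw [Ext.base_smul_of, hE, hE] at this
    simpa using this
  have hright (a : A) (b : B) : E (a * f b) = E a * b :=
    (e (Ext.of f 1)).map_smul (op b) (Ext.of f a)
  refine ⟨⟨E, hleft, hright, n, x, y, hxy, fun a => ?_⟩⟩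
  -- Both sides equal `∑ E(a xᵢ) E(yᵢ b)`. Since `e` is injective, an element `c` is determined by
  -- the map `b ↦ E(cb)`.
  have key (b : A) : E ((∑ i, f (E (a * x i)) * y i) * b) = E (a * b) := by
    rw [Finset.sum_mul, map_sum]
    simp only [mul_assoc, hleft]
    conv_rhs => rw [← hxy b, Finset.mul_sum, map_sum]
    simp only [← mul_assoc, hright]
  exact e.injective (LinearMap.ext fun b => (hE _ b).trans ((key b).trans (hE a b).symm))

namespace ExtensionFrobeniusSystem

variable (s : ExtensionFrobeniusSystem f)

theorem isFrobeniusExtension (s : ExtensionFrobeniusSystem f) : IsFrobeniusExtension f := by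
  let p : (Fin s.card → Bᵐᵒᵖ) →ₗ[Bᵐᵒᵖ] Ext f :=
    Fintype.linearCombination Bᵐᵒᵖ fun i => Ext.of f (s.x i)
  let q : Ext f →ₗ[Bᵐᵒᵖ] (Fin s.card → Bᵐᵒᵖ) :=
    { toFun := fun a i => op (s.form (s.y i * a.val))
      map_add' := fun a b => by
        ext i
        exact congr(op $((congrArg s.form (mul_add _ _ _)).trans (map_add _ _ _)))
      map_smul' := fun b a => by
        ext i
        exact congr(op $((congrArg s.form (mul_assoc _ _ _).symm).trans (s.form_right _ _))) }
  have hpq : p ∘ₗ q = LinearMap.id := by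
    ext a
    exact s.sum_left a
  refine ⟨Module.Finite.of_surjective p fun a => ⟨q a, congr($hpq a)⟩,
    Module.Projective.of_split q p hpq, ?_⟩
  let e : Ext f →+ (Ext f →ₗ[Bᵐᵒᵖ] B) :=
    { toFun := fun a =>
        { toFun := fun b => s.form (a.val * b.val)
          map_add' := fun b c => (congrArg s.form (mul_add _ _ _)).trans (map_add _ _ _)
          map_smul' := fun b c =>
            (congrArg s.form (mul_assoc _ _ _).symm).trans (s.form_right _ _) }
      map_zero' := by
        ext b
        exact (congrArg s.form (zero_mul _)).trans (map_zero _)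
      map_add' := fun a b => by
        ext c
        exact (congrArg s.form (add_mul _ _ _)).trans (map_add _ _ _) }
  have he : Function.Bijective e := by
    constructor
    · intro a b hab
      have h (i : Fin s.card) : s.form (a.val * s.x i) = s.form (b.val * s.x i) :=
        congr($hab (Ext.of f (s.x i)))
      change a.val = b.val
      rw [← s.sum_right a.val, ← s.sum_right b.val]
      simp only [h]
    · intro φ
      -- This element represents `φ`: `∑ φ(xᵢ) E(yᵢ b) = φ(∑ xᵢ E(yᵢ b)) = φ(b)`.
      refine ⟨Ext.of f (∑ i, f (φ (Ext.of f (s.x i))) * s.y i), ?_⟩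
      ext b
      change s.form ((∑ i, f (φ (Ext.of f (s.x i))) * s.y i) * b.val) = φ b
      have hb : b = ∑ i, op (s.form (s.y i * b.val)) • Ext.of f (s.x i) := (s.sum_left b).symm
      conv_rhs => rw [hb]
      rw [Finset.sum_mul, map_sum, map_sum]
      simp only [mul_assoc, s.form_left, map_smul]
      rfl
  exact ⟨AddEquiv.ofBijective e he, fun b x y =>
    (congrArg s.form (mul_assoc _ _ _)).trans (s.form_left _ _),
    fun x a y => congrArg s.form (mul_assoc _ _ _)⟩

/-- The map `a ⊗ b ↦ E(a) b`. -/
def formLeft : BTensor B (Ext f) (Ext f) →+ A :=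
  lift (AddMonoidHom.mk' (fun a : Ext f => AddMonoidHom.mk' (fun b : Ext f =>
      f (s.form a.val) * b.val) fun b c => mul_add (R := A) _ _ _)
      fun a b => by
        ext c
        exact (congrArg (fun z => f z * c.val) (map_add s.form _ _)).trans
          ((congrArg (· * c.val) (map_add f _ _)).trans (add_mul _ _ _)))
    fun a b c => by
      simp [s.form_right, mul_assoc]
      rfl

@[simp]
theorem formLeft_tmul (a b : Ext f) :
    s.formLeft (tmul B a b) = f (s.form a.val) * b.val := rfl

theorem formLeft_smul (b : B) (z : BTensor B (Ext f) (Ext f)) :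
    s.formLeft (f b • z) = f b * s.formLeft z := by
  induction z using induction_on with
  | zero => simp
  | tmul x y => simp [s.form_left, mul_assoc]
  | add x y hx hy => simp only [smul_add, map_add, mul_add, hx, hy]

theorem formLeft_op_smul (a : A) (z : BTensor B (Ext f) (Ext f)) :
    s.formLeft (op a • z) = s.formLeft z * a := by
  induction z using induction_on with
  | zero => simp
  | tmul x y => simp [mul_assoc]
  | add x y hx hy => simp only [smul_add, map_add, add_mul, hx, hy]

/-- The map `(a ⊗ b) ⊗ z ↦ a E(b z)`. -/
def pairing : BTensor B (Ext f) (Ext f) →+ BTensor B (Ext f) (Ext f) →+ A :=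
  lift (AddMonoidHom.mk' (fun a : Ext f => AddMonoidHom.mk' (fun b : Ext f =>
      AddMonoidHom.mk' (fun z => a.val * s.formLeft (b.val • z))
        fun z w => by simp [mul_add])
      fun b c => by
        ext z
        exact (congrArg (fun z => a.val * s.formLeft z) (add_smul b.val c.val z)).trans
          (by simp [mul_add]))
      fun a b => by
        ext c z
        exact add_mul a.val b.val _)
    fun a b c => by
      ext z
      simp [mul_smul, mul_assoc, s.formLeft_smul]

@[simp]
theorem pairing_tmul (a b : Ext f) (z : BTensor B (Ext f) (Ext f)) :
    s.pairing (tmul B a b) z = a.val * s.formLeft (b.val • z) := rfl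

/-- The bimodule map `(a ⊗ b) ⊗ (c ⊗ d) ↦ a E(bc) d`. -/
def sweedlerForm : BimoduleHom A
    (BTensor A (BTensor B (Ext f) (Ext f)) (BTensor B (Ext f) (Ext f))) A where
  toFun := lift s.pairing fun m a n => by
    induction m using induction_on with
    | zero => simp
    | tmul x y => simp [mul_smul]
    | add x y hx hy => simp only [smul_add, map_add, AddMonoidHom.add_apply, hx, hy]
  map_add' := map_add _
  map_smul' a z := by
    induction z using induction_on with
    | zero => simp
    | tmul c d =>
      induction c using induction_on with
      | zero => simp
      | tmul x y => simp [mul_assoc]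
      | add x y hx hy => simp only [smul_add, map_add, add_tmul, hx, hy]
    | add x y hx hy => simp only [smul_add, map_add, hx, hy]
  map_op_smul a z := by
    induction z using induction_on with
    | zero => simp
    | tmul c d =>
      induction c using induction_on with
      | zero => simp
      | tmul x y =>
        simp [mul_assoc, smul_comm y.val (op a) d, formLeft_op_smul]
      | add x y hx hy => simp only [smul_add, map_add, add_tmul, hx, hy]
    | add x y hx hy => simp only [smul_add, map_add, hx, hy]

theorem sweedlerForm_tmul (a b c d : Ext f) :
    s.sweedlerForm.left (tmul A (tmul B a b) (tmul B c d)) =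
      a.val * (f (s.form (b.val * c.val)) * d.val) := rfl

/-- Expand `a xᵢ` by the first dual basis identity, move the coefficients across the tensor sign,
and contract by the second: `∑ a xᵢ ⊗ yᵢ = ∑ xⱼ ⊗ E(yⱼ a xᵢ) yᵢ = ∑ xⱼ ⊗ yⱼ a`. -/
theorem dualBasis_central (a : A) :
    a • ∑ i, tmul B (Ext.of f (s.x i)) (Ext.of f (s.y i)) =
      op a • ∑ i, tmul B (Ext.of f (s.x i)) (Ext.of f (s.y i)) := by
  have h₁ (b : A) (z : Ext f) : tmul B (Ext.of f b) z =
      ∑ j, tmul B (Ext.of f (s.x j)) (s.form (s.y j * b) • z) := by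
    have hb : Ext.of f b = ∑ j, op (s.form (s.y j * b)) • Ext.of f (s.x j) :=
      (s.sum_left b).symm
    conv_lhs => rw [hb]
    change (mkHom B (Ext f) (Ext f)).flip z _ = _
    rw [map_sum]
    exact Finset.sum_congr rfl fun j _ => smul_tmul _ _ _
  have h₂ (j : Fin s.card) :
      ∑ i, s.form (s.y j * (a * s.x i)) • Ext.of f (s.y i) = Ext.of f (s.y j * a) := by
    refine Eq.trans ?_ (s.sum_right (s.y j * a))
    exact Finset.sum_congr rfl fun i _ =>
      congrArg (fun z => f (s.form z) * s.y i) (mul_assoc _ _ _).symm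
  simp only [Finset.smul_sum, left_smul_tmul, right_smul_tmul, Ext.smul_of, Ext.op_smul_of]
  simp only [h₁ (a * s.x _)]
  rw [Finset.sum_comm]
  refine Finset.sum_congr rfl fun j _ => ?_
  rw [← h₂ j]
  exact (map_sum (mkHom B (Ext f) (Ext f) _) _ _).symm

/-- On `a ⊗ b` and `p ⊗ q` the sides are `a ⊗ E(bp) q` and `a E(bp) ⊗ q`, equal because `E(bp)` lies
in `B`. -/
theorem sweedlerForm_comul (c d : BTensor B (Ext f) (Ext f)) :
    rid A _ (map LinearMap.id s.sweedlerForm.left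
      (assoc A A _ _ _ (tmul A ((sweedlerCoring f).comul.left c) d))) =
    lid A _ (map s.sweedlerForm.right LinearMap.id
      (assocInv A A _ _ _ (tmul A c ((sweedlerCoring f).comul.left d)))) := by
  induction c using induction_on with
  | zero => simp
  | tmul a b =>
    induction d using induction_on with
    | zero => simp
    | tmul p q =>
      change tmul B a (Ext.of f (1 * (1 * (f (s.form (b.val * p.val)) * q.val)))) =
        tmul B (Ext.of f (a.val * (f (s.form (b.val * p.val)) * 1) * 1)) q
      rw [one_mul, one_mul, mul_one, mul_one]
      exact (smul_tmul a (s.form (b.val * p.val)) q).symm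
    | add x y hx hy => simp only [map_add, tmul_add, hx, hy]
  | add x y hx hy => simp only [map_add, add_tmul, hx, hy]

/-- The Frobenius system of the Sweedler coring. -/
def sweedlerSystem : (sweedlerCoring f).FrobeniusSystem where
  elt := ∑ i, tmul B (Ext.of f (s.x i)) (Ext.of f (s.y i))
  form := s.sweedlerForm
  central := s.dualBasis_central
  form_comul := s.sweedlerForm_comul
  form_elt c := by
    induction c using induction_on with
    | zero => simp
    | tmul a b =>
      change s.sweedlerForm.left (mkHom A _ _ _ _) = a.val * b.val
      simp only [map_sum, mkHom_apply, sweedlerForm_tmul, Ext.val_of]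
      rw [← Finset.mul_sum, s.sum_right]
    | add x y hx hy => simp only [map_add, add_tmul, hx, hy]
  elt_form c := by
    induction c using induction_on with
    | zero => simp
    | tmul a b =>
      change s.sweedlerForm.left ((mkHom A _ _).flip _ _) = a.val * b.val
      simp only [map_sum, AddMonoidHom.flip_apply, mkHom_apply, sweedlerForm_tmul, Ext.val_of,
        ← mul_assoc]
      rw [← Finset.sum_mul, s.sum_left]
    | add x y hx hy => simp only [map_add, tmul_add, hx, hy]

end ExtensionFrobeniusSystem

end

/-! ### Faithfully flat descent along `B → A` -/

section

universe u v w

section Reflect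

/-- The equivalence `e ⊗ e'`. -/
def BTensor.congr {S M N M' N' : Type*} [Ring S] [AddCommGroup M] [Module Sᵐᵒᵖ M]
    [AddCommGroup N] [Module S N] [AddCommGroup M'] [Module Sᵐᵒᵖ M']
    [AddCommGroup N'] [Module S N'] (e : M ≃ₗ[Sᵐᵒᵖ] M') (e' : N ≃ₗ[S] N') :
    BTensor S M N ≃+ BTensor S M' N' :=
  AddMonoidHom.toAddEquiv (map e.toLinearMap e'.toLinearMap)
    (map e.symm.toLinearMap e'.symm.toLinearMap)
    (hom_ext fun _ _ => by simp) (hom_ext fun _ _ => by simp)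

theorem BTensor.congr_apply {S M N M' N' : Type*} [Ring S] [AddCommGroup M] [Module Sᵐᵒᵖ M]
    [AddCommGroup N] [Module S N] [AddCommGroup M'] [Module Sᵐᵒᵖ M']
    [AddCommGroup N'] [Module S N'] (e : M ≃ₗ[Sᵐᵒᵖ] M') (e' : N ≃ₗ[S] N')
    (x : BTensor S M N) :
    BTensor.congr e e' x = map e.toLinearMap e'.toLinearMap x := rfl

/-- Faithful flatness tests modules of a single universe. Transport along isomorphisms lets it
reflect exactness for `B`, `A` and `A ⊗_B A`, which live in different universes. -/
theorem IsFaithfullyFlatLeft.exact {B : Type u} {N : Type v} [Ring B] [AddCommGroup N]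
    [Module B N] (h : IsFaithfullyFlatLeft.{w} B N)
    {M₁ M₂ M₃ : Type*} [AddCommGroup M₁] [AddCommGroup M₂] [AddCommGroup M₃]
    [Module Bᵐᵒᵖ M₁] [Module Bᵐᵒᵖ M₂] [Module Bᵐᵒᵖ M₃]
    {L₁ L₂ L₃ : Type w} [AddCommGroup L₁] [AddCommGroup L₂] [AddCommGroup L₃]
    [Module Bᵐᵒᵖ L₁] [Module Bᵐᵒᵖ L₂] [Module Bᵐᵒᵖ L₃]
    (e₁ : L₁ ≃ₗ[Bᵐᵒᵖ] M₁) (e₂ : L₂ ≃ₗ[Bᵐᵒᵖ] M₂) (e₃ : L₃ ≃ₗ[Bᵐᵒᵖ] M₃)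
    (g : M₁ →ₗ[Bᵐᵒᵖ] M₂) (k : M₂ →ₗ[Bᵐᵒᵖ] M₃)
    (hgk : Function.Exact (map g (LinearMap.id : N →ₗ[B] N))
      (map k (LinearMap.id : N →ₗ[B] N))) : Function.Exact g k := by
  let g' : L₁ →ₗ[Bᵐᵒᵖ] L₂ := e₂.symm.toLinearMap ∘ₗ g ∘ₗ e₁.toLinearMap
  let k' : L₂ →ₗ[Bᵐᵒᵖ] L₃ := e₃.symm.toLinearMap ∘ₗ k ∘ₗ e₂.toLinearMap
  have h₁ : Function.Exact (map g' (LinearMap.id : N →ₗ[B] N))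
      (map k' (LinearMap.id : N →ₗ[B] N)) :=
    (Function.Exact.iff_of_ladder_addEquiv (BTensor.congr e₁ (.refl B N))
      (BTensor.congr e₂ (.refl B N)) (BTensor.congr e₃ (.refl B N))
      (hom_ext fun _ _ => by simp [BTensor.congr_apply, g'])
      (hom_ext fun _ _ => by simp [BTensor.congr_apply, k'])).1 hgk
  have h₂ := (h L₁ L₂ L₃ g' k').2 h₁
  exact (Function.Exact.iff_of_ladder_linearEquiv (e₁ := e₁) (e₂ := e₂) (e₃ := e₃)
    (f₁₂ := g') (f₂₃ := k') (by ext; simp [g']) (by ext; simp [k'])).2 h₂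

theorem IsFaithfullyFlatRight.exact {B : Type u} {M : Type v} [Ring B] [AddCommGroup M]
    [Module Bᵐᵒᵖ M] (h : IsFaithfullyFlatRight.{w} B M)
    {N₁ N₂ N₃ : Type*} [AddCommGroup N₁] [AddCommGroup N₂] [AddCommGroup N₃]
    [Module B N₁] [Module B N₂] [Module B N₃]
    {L₁ L₂ L₃ : Type w} [AddCommGroup L₁] [AddCommGroup L₂] [AddCommGroup L₃]
    [Module B L₁] [Module B L₂] [Module B L₃]
    (e₁ : L₁ ≃ₗ[B] N₁) (e₂ : L₂ ≃ₗ[B] N₂) (e₃ : L₃ ≃ₗ[B] N₃)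
    (g : N₁ →ₗ[B] N₂) (k : N₂ →ₗ[B] N₃)
    (hgk : Function.Exact (map (LinearMap.id : M →ₗ[Bᵐᵒᵖ] M) g)
      (map (LinearMap.id : M →ₗ[Bᵐᵒᵖ] M) k)) : Function.Exact g k := by
  let g' : L₁ →ₗ[B] L₂ := e₂.symm.toLinearMap ∘ₗ g ∘ₗ e₁.toLinearMap
  let k' : L₂ →ₗ[B] L₃ := e₃.symm.toLinearMap ∘ₗ k ∘ₗ e₂.toLinearMap
  have h₁ : Function.Exact (map (LinearMap.id : M →ₗ[Bᵐᵒᵖ] M) g')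
      (map (LinearMap.id : M →ₗ[Bᵐᵒᵖ] M) k') :=
    (Function.Exact.iff_of_ladder_addEquiv (BTensor.congr (.refl Bᵐᵒᵖ M) e₁)
      (BTensor.congr (.refl Bᵐᵒᵖ M) e₂) (BTensor.congr (.refl Bᵐᵒᵖ M) e₃)
      (hom_ext fun _ _ => by simp [BTensor.congr_apply, g'])
      (hom_ext fun _ _ => by simp [BTensor.congr_apply, k'])).1 hgk
  have h₂ := (h L₁ L₂ L₃ g' k').2 h₁
  exact (Function.Exact.iff_of_ladder_linearEquiv (e₁ := e₁) (e₂ := e₂) (e₃ := e₃)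
    (f₁₂ := g') (f₂₃ := k') (by ext; simp [g']) (by ext; simp [k'])).2 h₂

end Reflect

variable {B : Type u} {A : Type v} [Ring B] [Ring A] {f : B →+* A}

namespace Ext

instance (f : B →+* A) : SMulCommClass B Bᵐᵒᵖ (Ext f) :=
  ⟨fun a b x => smul_comm (M := A) (N := Aᵐᵒᵖ) (α := A) (f a) (f.op b) x⟩

instance (f : B →+* A) : SMulCommClass Bᵐᵒᵖ B (Ext f) := SMulCommClass.symm _ _ _

variable (f) in
/-- The map `f` as a right `B`-linear map. -/
def rightLin : B →ₗ[Bᵐᵒᵖ] Ext f where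
  toFun b := of f (f b)
  map_add' := map_add f
  map_smul' b c := map_mul f c b.unop

variable (f) in
/-- The map `f` as a left `B`-linear map. -/
def leftLin : B →ₗ[B] Ext f where
  toFun b := of f (f b)
  map_add' := map_add f
  map_smul' b c := map_mul f b c

@[simp] theorem rightLin_apply (b : B) : rightLin f b = of f (f b) := rfl
@[simp] theorem leftLin_apply (b : B) : leftLin f b = of f (f b) := rfl

theorem of_map_tmul (b : B) (x : Ext f) : tmul B (of f (f b)) x = tmul B (of f 1) (b • x) := by
  rw [← smul_tmul]
  simp

variable (f) in
/-- The map `a ↦ a ⊗ 1 - 1 ⊗ a`. -/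
def diff : Ext f →+ BTensor B (Ext f) (Ext f) :=
  (mkHom B (Ext f) (Ext f)).flip (of f 1) - mkHom B (Ext f) (Ext f) (of f 1)

theorem diff_apply (x : Ext f) : diff f x = tmul B x (of f 1) - tmul B (of f 1) x := rfl

variable (f) in
/-- `diff` as a right `B`-linear map. -/
def diffRight : Ext f →ₗ[Bᵐᵒᵖ] BTensor B (Ext f) (Ext f) where
  __ := diff f
  map_smul' b x := by
    change diff f (op b.unop • x) = op b.unop • diff f x
    simp only [diff_apply, smul_sub, right_smul_tmul, smul_tmul, base_smul_of, base_op_smul_of,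
      one_mul, mul_one]

variable (f) in
/-- `diff` as a left `B`-linear map. -/
def diffLeft : Ext f →ₗ[B] BTensor B (Ext f) (Ext f) where
  __ := diff f
  map_smul' b x := by
    change diff f (b • x) = b • diff f x
    simp only [diff_apply, smul_sub, left_smul_tmul, ← smul_tmul, base_smul_of, base_op_smul_of,
      one_mul, mul_one]

@[simp] theorem diffRight_apply (x : Ext f) : diffRight f x = diff f x := rfl
@[simp] theorem diffLeft_apply (x : Ext f) : diffLeft f x = diff f x := rfl

theorem diff_of_map (b : B) : diff f (of f (f b)) = 0 := by
  rw [diff_apply, of_map_tmul, sub_eq_zero]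
  simp

variable (f) in
/-- The multiplication map `A ⊗_B A → A`. -/
def mulHom : BTensor B (Ext f) (Ext f) →+ Ext f := (sweedlerCounit f).left.toAddMonoidHom

@[simp] theorem mulHom_tmul (x y : Ext f) : mulHom f (tmul B x y) = of f (x.val * y.val) := rfl

variable (f) in
/-- The multiplication map as a right `B`-linear map. -/
def mulRight : BTensor B (Ext f) (Ext f) →ₗ[Bᵐᵒᵖ] Ext f where
  __ := mulHom f
  map_smul' b x := by
    change mulHom f (op b.unop • x) = op b.unop • mulHom f x
    induction x using induction_on with
    | zero => simp
    | tmul x y => exact congrArg (of f) (mul_assoc _ _ _).symm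
    | add x y hx hy => simp only [smul_add, map_add, hx, hy]

variable (f) in
/-- The multiplication map as a left `B`-linear map. -/
def mulLeft : BTensor B (Ext f) (Ext f) →ₗ[B] Ext f where
  __ := mulHom f
  map_smul' b x := by
    change mulHom f (b • x) = b • mulHom f x
    induction x using induction_on with
    | zero => simp
    | tmul x y => simp [mul_assoc]
    | add x y hx hy => simp only [smul_add, map_add, hx, hy]

@[simp] theorem mulRight_apply (z) : mulRight f z = mulHom f z := rfl
@[simp] theorem mulLeft_apply (z) : mulLeft f z = mulHom f z := rfl

end Ext

open Ext

/-- A contracting homotopy: once tensored with `A`, the sequence `0 → B → A → A ⊗_B A` is contracted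
by multiplying the last two factors. The mirror statement below multiplies the first two. -/
theorem map_diffRight_contract (z : BTensor B (Ext f) (Ext f)) :
    map LinearMap.id (mulLeft f) (assocHom B B (Ext f) (Ext f) (Ext f)
      (map (diffRight f) LinearMap.id z)) = z - tmul B (of f 1) (mulHom f z) := by
  induction z using induction_on with
  | zero => simp
  | tmul x y =>
    rw [map_tmul, ← mkHom_apply, diffRight_apply, diff_apply, map_sub]
    simp
  | add x y hx hy => simp only [map_add, tmul_add, hx, hy]; abel

theorem map_diffLeft_contract (z : BTensor B (Ext f) (Ext f)) :
    map (mulRight f) LinearMap.id (assocInv B B (Ext f) (Ext f) (Ext f)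
      (map LinearMap.id (diffLeft f) z)) = tmul B (mulHom f z) (of f 1) - z := by
  induction z using induction_on with
  | zero => simp
  | tmul x y =>
    rw [map_tmul, ← mkHom_apply, diffLeft_apply, diff_apply, map_sub]
    simp
  | add x y hx hy => simp only [map_add, add_tmul, hx, hy]; abel

/-- Exactness after a zero map encodes injectivity. Here `b ⊗ x ↦ f(b) ⊗ x` has the left inverse `z
↦ 1 ⊗ μ(z)`, with `μ` the multiplication. -/
theorem exact_map_zero_rightLin :
    Function.Exact (map (0 : B →ₗ[Bᵐᵒᵖ] B) (LinearMap.id : Ext f →ₗ[B] Ext f))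
      (map (rightLin f) (LinearMap.id : Ext f →ₗ[B] Ext f)) := by
  have h₁ (z : BTensor B B (Ext f)) :
      z = tmul B 1 (mulHom f (map (rightLin f) LinearMap.id z)) := by
    induction z using induction_on with
    | zero => simp
    | tmul b x =>
      have := smul_tmul (1 : B) b x
      rw [_root_.op_smul_eq_mul, one_mul] at this
      rw [map_tmul, rightLin_apply, LinearMap.id_apply, mulHom_tmul, val_of, ← base_smul_of,
        of_val, ← this]
    | add x y hx hy => rw [map_add, map_add, tmul_add, ← hx, ← hy]
  intro z
  refine ⟨fun hz => ⟨0, ?_⟩, ?_⟩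
  · rw [h₁ z, hz]
    simp
  · rintro ⟨w, rfl⟩
    induction w using induction_on with
    | zero => simp
    | tmul b x => simp
    | add x y hx hy => simp only [map_add, hx, hy, add_zero]

theorem exact_map_rightLin_diffRight :
    Function.Exact (map (rightLin f) (LinearMap.id : Ext f →ₗ[B] Ext f))
      (map (diffRight f) (LinearMap.id : Ext f →ₗ[B] Ext f)) := by
  intro z
  constructor
  · intro hz
    have h := map_diffRight_contract z
    rw [hz, map_zero, map_zero] at h
    exact ⟨tmul B 1 (mulHom f z), by simpa using (sub_eq_zero.1 h.symm).symm⟩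
  · rintro ⟨w, rfl⟩
    induction w using induction_on with
    | zero => simp
    | tmul b x => simp [diff_of_map]
    | add x y hx hy => simp only [map_add, hx, hy, add_zero]

theorem exact_map_zero_leftLin :
    Function.Exact (map (LinearMap.id : Ext f →ₗ[Bᵐᵒᵖ] Ext f) (0 : B →ₗ[B] B))
      (map (LinearMap.id : Ext f →ₗ[Bᵐᵒᵖ] Ext f) (leftLin f)) := by
  have h₁ (z : BTensor B (Ext f) B) :
      z = tmul B (mulHom f (map LinearMap.id (leftLin f) z)) 1 := by
    induction z using induction_on with
    | zero => simp
    | tmul x b =>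
      have := smul_tmul x b (1 : B)
      rw [smul_eq_mul, mul_one] at this
      rw [map_tmul, leftLin_apply, LinearMap.id_apply, mulHom_tmul, val_of,
        ← base_op_smul_of, of_val, this]
    | add x y hx hy => rw [map_add, map_add, add_tmul, ← hx, ← hy]
  intro z
  refine ⟨fun hz => ⟨0, ?_⟩, ?_⟩
  · rw [h₁ z, hz]
    simp
  · rintro ⟨w, rfl⟩
    induction w using induction_on with
    | zero => simp
    | tmul b x => simp
    | add x y hx hy => simp only [map_add, hx, hy, add_zero]

theorem exact_map_leftLin_diffLeft :
    Function.Exact (map (LinearMap.id : Ext f →ₗ[Bᵐᵒᵖ] Ext f) (leftLin f))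
      (map (LinearMap.id : Ext f →ₗ[Bᵐᵒᵖ] Ext f) (diffLeft f)) := by
  intro z
  constructor
  · intro hz
    have h := map_diffLeft_contract z
    rw [hz, map_zero, map_zero] at h
    exact ⟨tmul B (mulHom f z) 1, by simpa using sub_eq_zero.1 h.symm⟩
  · rintro ⟨w, rfl⟩
    induction w using induction_on with
    | zero => simp
    | tmul b x => simp [diff_of_map]
    | add x y hx hy => simp only [map_add, hx, hy, add_zero]

/-- The sequence `0 → B → A → A ⊗_B A` with second map `a ↦ a ⊗ 1 - 1 ⊗ a` becomes exact after
tensoring with `A`, so it was already exact. -/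
theorem IsFaithfullyFlatLeft.descent
    (h : IsFaithfullyFlatLeft.{max u v} B (Ext f)) :
    Function.Injective f ∧ ∀ a : A, tmul B (of f a) (of f 1) = tmul B (of f 1) (of f a) →
      ∃ b, f b = a := by
  constructor
  · have := h.exact (ULift.moduleEquiv.{u, u, max u v}) ULift.moduleEquiv.{u, u, max u v}
      ULift.moduleEquiv.{u, v, max u v} _ _ exact_map_zero_rightLin
    refine (injective_iff_map_eq_zero f).2 fun b hb => ?_
    obtain ⟨c, hc⟩ := (this b).1 hb
    exact hc.symm
  · intro a ha
    have := h.exact ULift.moduleEquiv.{u, u, max u v}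
      ULift.moduleEquiv.{u, v, max u v} ULift.moduleEquiv.{u, v, max u v} _ _
      (exact_map_rightLin_diffRight (f := f))
    exact (this (of f a)).1 (sub_eq_zero.2 ha)

theorem IsFaithfullyFlatRight.descent
    (h : IsFaithfullyFlatRight.{max u v} B (Ext f)) :
    Function.Injective f ∧ ∀ a : A, tmul B (of f a) (of f 1) = tmul B (of f 1) (of f a) →
      ∃ b, f b = a := by
  constructor
  · have := h.exact (ULift.moduleEquiv.{u, u, max u v}) ULift.moduleEquiv.{u, u, max u v}
      ULift.moduleEquiv.{u, v, max u v} _ _ exact_map_zero_leftLin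
    refine (injective_iff_map_eq_zero f).2 fun b hb => ?_
    obtain ⟨c, hc⟩ := (this b).1 hb
    exact hc.symm
  · intro a ha
    have := h.exact ULift.moduleEquiv.{u, u, max u v}
      ULift.moduleEquiv.{u, v, max u v} ULift.moduleEquiv.{u, v, max u v} _ _
      (exact_map_leftLin_diffLeft (f := f))
    exact (this (of f a)).1 (sub_eq_zero.2 ha)

/-! ### Recovering the Frobenius homomorphism and the dual bases -/

namespace Coring.FrobeniusSystem

variable (s : (sweedlerCoring f).FrobeniusSystem)

/-- The map `a ↦ π((1 ⊗ a) ⊗ (1 ⊗ 1))`. -/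
def endo : A →+ A :=
  (s.form.left.toAddMonoidHom.comp ((mkHom A (BTensor B (Ext f) (Ext f))
    (BTensor B (Ext f) (Ext f))).flip (tmul B (of f 1) (of f 1)))).comp
      (mkHom B (Ext f) (Ext f) (of f 1))

theorem endo_apply (a : A) : s.endo a =
    s.form.left (tmul A (tmul B (of f 1) (of f a)) (tmul B (of f 1) (of f 1))) := rfl

/-- The outer factors come out by bilinearity, and `c` moves across `⊗_A` to join `b`. -/
theorem form_tmul (a b c d : A) :
    s.form.left (tmul A (tmul B (of f a) (of f b)) (tmul B (of f c) (of f d))) =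
      a * s.endo (b * c) * d := by
  have h₁ := s.form.left.map_smul a
    (tmul A (tmul B (of f 1) (of f b)) (tmul B (of f c) (of f d)))
  have h₂ : s.form.left (op d • _) = op d • s.form.left _ := s.form.map_op_smul d
    (tmul A (tmul B (of f 1) (of f b)) (tmul B (of f c) (of f 1)))
  have h₃ := smul_tmul (tmul B (of f 1) (of f b)) c (tmul B (of f 1) (of f 1))
  simp only [left_smul_tmul, right_smul_tmul, smul_of, op_smul_of, mul_one, one_mul,
    smul_eq_mul, _root_.op_smul_eq_mul] at h₁ h₂ h₃
  rw [h₁, h₂, ← h₃, mul_assoc]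
  rfl

/-- This is `form_comul` at `1 ⊗ a` and `1 ⊗ 1`. -/
theorem tmul_endo (a : A) :
    tmul B (of f (s.endo a)) (of f 1) = tmul B (of f 1) (of f (s.endo a)) := by
  have h : tmul B (of f 1) (of f (1 * s.form.left
      (tmul A (tmul B (of f 1) (of f a)) (tmul B (of f 1) (of f 1))))) =
      tmul B (of f (s.form.left (tmul A (tmul B (of f 1) (of f a))
        (tmul B (of f 1) (of f 1))) * 1)) (of f 1) :=
    s.form_comul (tmul B (of f 1) (of f a)) (tmul B (of f 1) (of f 1))
  rw [one_mul, mul_one] at h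
  exact h.symm

theorem endo_left (b : B) (a : A) : s.endo (f b * a) = f b * s.endo a := by
  have h : tmul B (of f 1) (of f (f b * a)) = f b • tmul B (of f 1) (of f a) := by
    rw [← base_smul_of, ← smul_tmul, left_smul_tmul]
    simp
  rw [endo_apply, h, ← left_smul_tmul, map_smul]
  rfl

/-- Since `f(b) ⊗ 1 = 1 ⊗ f(b)`, `form_tmul` computes the same value of `π` in two ways. -/
theorem endo_right (a : A) (b : B) : s.endo (a * f b) = s.endo a * f b := by
  have h := s.form_tmul 1 a (f b) 1
  have h' := s.form_tmul 1 a 1 (f b)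
  rw [of_map_tmul] at h
  simp only [base_smul_of, mul_one, one_mul] at h h'
  rw [← h, h']

theorem nonempty_extensionFrobeniusSystem
    (s : (sweedlerCoring f).FrobeniusSystem) (hf : Function.Injective f)
    (hf' : ∀ a : A, tmul B (of f a) (of f 1) = tmul B (of f 1) (of f a) → ∃ b, f b = a) :
    Nonempty (ExtensionFrobeniusSystem f) := by
  choose E hE using fun a => hf' _ (s.tmul_endo a)
  obtain ⟨n, x, y, hxy⟩ := exists_eq_sum s.elt
  refine ⟨⟨AddMonoidHom.mk' E fun a b => hf (by simp only [map_add, hE]),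
    fun b a => hf ?_, fun a b => hf ?_, n, fun i => (x i).val, fun i => (y i).val,
    fun a => ?_, fun a => ?_⟩⟩
  · simp only [AddMonoidHom.mk'_apply, map_mul, hE, endo_left]
  · simp only [AddMonoidHom.mk'_apply, map_mul, hE, endo_right]
  -- With `e = ∑ xᵢ ⊗ yᵢ`, the equation `π(e ⊗ (a ⊗ 1)) = ε(a ⊗ 1)` reads `∑ xᵢ E(yᵢ a) = a`; the
  -- other identity comes from `π((1 ⊗ a) ⊗ e)`.
  · have h : s.form.left ((mkHom A _ _).flip _ _) = a * 1 :=
      s.elt_form (tmul B (of f a) (of f 1))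
    rw [hxy, map_sum, map_sum, mul_one] at h
    refine Eq.trans (Finset.sum_congr rfl fun i _ => ?_) h
    simpa [hE] using (s.form_tmul (x i).val (y i).val a 1).symm
  · have h : s.form.left (mkHom A _ _ _ _) = 1 * a :=
      s.form_elt (tmul B (of f 1) (of f a))
    rw [hxy, map_sum, map_sum, one_mul] at h
    refine Eq.trans (Finset.sum_congr rfl fun i _ => ?_) h
    simpa [hE] using (s.form_tmul 1 a (x i).val (y i).val).symm

end Coring.FrobeniusSystem

end

end NC

universe u v

theorem theorem2p7 {B : Type u} {A : Type v} [Ring B] [Ring A] (f : B →+* A) :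
    (NC.IsFrobeniusExtension f → (NC.sweedlerCoring f).IsFrobenius) ∧
    ((NC.IsFaithfullyFlatLeft.{max u v} B (NC.Ext f) ∨
        NC.IsFaithfullyFlatRight.{max u v} B (NC.Ext f)) →
      (NC.sweedlerCoring f).IsFrobenius → NC.IsFrobeniusExtension f) := by
  refine ⟨fun h => ?_, fun hf h => ?_⟩
  · obtain ⟨s⟩ := h.nonempty_system
    exact s.sweedlerSystem.isFrobenius
  · obtain ⟨s⟩ := h.nonempty_frobeniusSystem
    obtain ⟨h₁, h₂⟩ := hf.elim (·.descent) (·.descent)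
    obtain ⟨t⟩ := s.nonempty_extensionFrobeniusSystem h₁ h₂
    exact t.isFrobeniusExtension
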